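/- Let $\mathsf{TOF}$ be the strict symmetric monoidal category with objects the natural numbers ($n\otimes m=n+m$; maps $n\to m$ are circuits with $n$ input and $m$ output wires, wires being numbered $0,1,2,\dots$ from top to bottom) generated by the ancillae $|1\rangle:0\to1$ and $\langle1|:1\to0$ and the Toffoli gate $\mathsf{tof}:3\to3$ (controls $0,1$, target $2$), subject to the identities below. Juxtaposition $fg$ means first $f$, then $g$; $\otimes$ puts its first factor on top. Put $\mathsf{cnot}:=(|1\rangle\otimes1_2)\,\mathsf{tof}\,(\langle1|\otimes1_2)$ (control $0$, target $1$), $\mathsf{not}:=(|1\rangle\otimes1_1)\,\mathsf{cnot}\,(\langle1|\otimes1_1)$, $|0\rangle:=|1\rangle\,\mathsf{not}$ and $\langle0|:=\mathsf{not}\,\langle1|$. Gates may be placed on arbitrary distinct wires of a larger circuit by conjugating with wire crossings: $T^{ab}_c$ and $C^a_c$ denote $\mathsf{tof}$ and $\mathsf{cnot}$ placed with controls $a,b$ (resp. $a$), in this order, and target $c$. Let $\rhd_z$ and $\lhd_z$ denote $|0\rangle$ creating, and $\langle0|$ terminating, the wire in position $z$, and let $\blacktriangleright_z$ be the same for $|1\rangle$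 creating a wire. The identities are: 1. $(|1\rangle\otimes1_2)\,\mathsf{tof}=|1\rangle\otimes\mathsf{cnot}$ and $\mathsf{tof}\,(\langle1|\otimes1_2)=\langle1|\otimes\mathsf{cnot}$; 2. $(|0\rangle\otimes1_2)\,\mathsf{tof}=|0\rangle\otimes1_2$ and $\mathsf{tof}\,(\langle0|\otimes1_2)=\langle0|\otimes1_2$; 3. $T^{01}_2T^{43}_2=T^{43}_2T^{01}_2$ and $T^{21}_0T^{23}_4=T^{23}_4T^{21}_0$ on five wires; $T^{21}_0T^{12}_3=T^{12}_3T^{21}_0$ and $T^{02}_3T^{12}_3=T^{12}_3T^{02}_3$ on four wires; 4. $\blacktriangleright_2C^0_2\lhd_2\blacktriangleright_2C^1_2\lhd_2=\blacktriangleright_2T^{01}_2\lhd_2$ as maps $2\to2$; 5. $(|1\rangle\langle0|)\otimes1_1=(|1\rangle\langle0|)\otimes(\langle1|\,|1\rangle)$ (diagrammatic order, so that $|1\rangle\langle0|:0\to0$ and $\langle 1|\,|1\rangle:1\to1$), and $|1\rangle\langle1|=1_0$; 6. $\mathsf{tof}\,\mathsf{tof}=1_3$; 7. on four wires, $T^{12}_3T^{01}_2T^{12}_3=T^{01}_3T^{01}_2$,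 $\;C^0_1T^{12}_3C^0_1=T^{02}_3T^{12}_3$, $\;T^{01}_2T^{12}_3T^{01}_2=T^{01}_3T^{12}_3$, $\;T^{01}_2C^2_3T^{01}_2=T^{01}_3C^2_3$; 8. on two wires, $C^0_1C^1_0C^0_1$ is the crossing of the two wires; 9. $\mathsf{tof}$ is unchanged by conjugation with the crossing of its two control wires, and $\rhd_2T^{01}_2T^{23}_4T^{01}_2\lhd_2:4\to4$ is unchanged by conjugation with the crossing of the wires $1$ and $2$. Define $\mathsf{cnot}_n:n+1\to n+1$ (controls $0,\dots,n-1$, target $n$) by $\mathsf{cnot}_0=\mathsf{not}$, $\mathsf{cnot}_1=\mathsf{cnot}$, $\mathsf{cnot}_2=\mathsf{tof}$ and, for $n\ge2$, $\mathsf{cnot}_{n+1}=\rhd_2\,T^{01}_2\,(1_2\otimes\mathsf{cnot}_n)\,T^{01}_2\,\lhd_2$. For a set $X$ of wires of a circuit and a wire $x\notin X$, let $\oplus_x^X$ be $\mathsf{cnot}_{|X|}$ placed with the wires in $X$ (in increasing order) as its controls and $x$ as its target; the other wires pass through. **Lemma (Iwama's identities).** The following hold in $\mathsf{TOF}$, for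 any number of wires, any wires $x,y,z$ and any sets $X,Y$ of wires for which all gates that occur are defined (no target wire lies in its own control set; $\sqcup$ denotes a union required to be disjoint; in (ii) and (vi) the gates act on the wires of the circuit that include the newly created wire): - (i) $\oplus_x^X\oplus_x^X=1$; - (ii) if $x\in X$ then $\rhd_x\oplus_y^X=\rhd_x$; - (iii) $\oplus_x^X\oplus_x^Y=\oplus_x^Y\oplus_x^X$; - (iv) if $x\notin Y$ and $y\notin X$ then $\oplus_x^X\oplus_y^Y=\oplus_y^Y\oplus_x^X$; - (v) $\oplus_x^X\oplus_y^{\{x\}\sqcup Y}=\oplus_y^{X\cup Y}\oplus_y^{\{x\}\sqcup Y}\oplus_x^X$; - (vi) $\rhd_z\oplus_z^{\{x\}}\oplus_y^{\{x\}\sqcup X}=\rhd_z\oplus_z^{\{x\}}\oplus_y^{\{z\}\sqcup X}$. -/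

import Mathlib

open CategoryTheory

/-- Circuit terms `n → m` over the generators `|1⟩`, `⟨1|` and the Toffoli gate. Wires are numbered
from top (`0`) to bottom. `perm σ` is a pure wire crossing: it takes the wire in position `i` to
position `σ i`. Composition is diagrammatic, and `tensor f g` stacks `f` on top of `g`. -/
inductive Circ : ℕ → ℕ → Type
  | ket1 : Circ 0 1
  | bra1 : Circ 1 0
  | tof : Circ 3 3
  | perm {n m : ℕ} (σ : Fin n ≃ Fin m) : Circ n m
  | comp {n m k : ℕ} (f : Circ n m) (g : Circ m k) : Circ n k
  | tensor {n m n' m' : ℕ} (f : Circ n m) (g : Circ n' m') : Circ (n + n') (m + m')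

namespace Circ

/-- Juxtaposition of two bijections: the first on the upper wires, the second on the lower ones. -/
def sumPerm {n m n' m' : ℕ} (σ : Fin n ≃ Fin m) (τ : Fin n' ≃ Fin m') :
    Fin (n + n') ≃ Fin (m + m') :=
  finSumFinEquiv.symm.trans ((Equiv.sumCongr σ τ).trans finSumFinEquiv)

/-- The identity circuit. -/
def id (n : ℕ) : Circ n n := perm (Equiv.refl _)

/-- An enumeration of all `n` wires that starts with the wires `w 0, …, w (k - 1)` and continues with
the remaining ones in increasing order. -/
noncomputable def wireEquiv {k n : ℕ} (w : Fin k ↪ Fin n) : Fin (k + (n - k)) ≃ Fin n :=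
  finSumFinEquiv.symm.trans <|
    (Equiv.sumCongr
      ((Equiv.ofBijective (fun i => (⟨w i, Finset.mem_map_of_mem w (Finset.mem_univ i)⟩ :
          {a // a ∈ Finset.univ.map w}))
        ⟨fun i j h => w.injective (congrArg Subtype.val h), fun ⟨a, ha⟩ => by
          obtain ⟨i, -, rfl⟩ := Finset.mem_map.1 ha
          exact ⟨i, rfl⟩⟩))
      ((((Finset.univ.map w)ᶜ).orderIsoOfFin
          (by rw [Finset.card_compl, Finset.card_map, Finset.card_fin, Fintype.card_fin])).toEquiv.trans
        (Equiv.subtypeEquivRight (fun a => Finset.mem_compl)))).trans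
    (Equiv.sumCompl (fun a => a ∈ Finset.univ.map w))

/-- The gate `g` placed (with gaps and crossings) on the wires of an `n`-wire circuit: the `i`-th wire
of `g` is the wire `w i` of the circuit, and all other wires pass through unchanged. -/
noncomputable def on {k n : ℕ} (g : Circ k k) (w : Fin k ↪ Fin n) : Circ n n :=
  comp (comp (perm (wireEquiv w).symm) (tensor g (id (n - k)))) (perm (wireEquiv w))

/-- The bijection taking the last position to `z`, and the others to the remaining positions in
increasing order. -/
def lastTo {n : ℕ} (z : Fin (n + 1)) : Fin (n + 1) ≃ Fin (n + 1) :=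
  (finSuccEquiv' (Fin.last n)).trans (finSuccEquiv' z).symm

/-- Creation of a new wire in position `z` by the input ancilla `g`. -/
def insertAt {n : ℕ} (g : Circ 0 1) (z : Fin (n + 1)) : Circ n (n + 1) :=
  comp (tensor (id n) g) (perm (lastTo z))

/-- Termination of the wire in position `z` by the output ancilla `g`. -/
def removeAt {n : ℕ} (g : Circ 1 0) (z : Fin (n + 1)) : Circ (n + 1) n :=
  comp (perm (lastTo z).symm) (tensor (id n) g)

/-- The controlled not gate; the control is wire `0`, the target is wire `1`. -/
def cnot : Circ 2 2 := comp (comp (tensor ket1 (id 2)) tof) (tensor bra1 (id 2))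

/-- The not gate. -/
def not : Circ 1 1 := comp (comp (tensor ket1 (id 1)) cnot) (tensor bra1 (id 1))

/-- The input ancilla `|0⟩`. -/
def ket0 : Circ 0 1 := comp ket1 not

/-- The output ancilla `⟨0|`. -/
def bra0 : Circ 1 0 := comp not bra1

/-- The Toffoli gate on an `n`-wire circuit with controls `a`, `b` and target `c`. -/
noncomputable def tofOn {n : ℕ} (a b c : Fin n) (h : Function.Injective ![a, b, c] := by decide) : Circ n n :=
  tof.on ⟨![a, b, c], h⟩

/-- The controlled not gate on an `n`-wire circuit with control `a` and target `c`. -/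
noncomputable def cnotOn {n : ℕ} (a c : Fin n) (h : Function.Injective ![a, c] := by decide) : Circ n n :=
  cnot.on ⟨![a, c], h⟩

/-- Equality of circuits in `TOF`: the congruence generated by the laws of symmetric (strict)
monoidal categories with objects the natural numbers and by the identities between circuits of
Toffoli gates and ancillae. -/
inductive Eqv : ∀ {n m : ℕ}, Circ n m → Circ n m → Prop
  -- equivalence relation and congruence
  | refl {n m : ℕ} (f : Circ n m) : Eqv f f
  | symm {n m : ℕ} {f g : Circ n m} : Eqv f g → Eqv g f
  | trans {n m : ℕ} {f g h : Circ n m} : Eqv f g → Eqv g h → Eqv f h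
  | comp_congr {n m k : ℕ} {f f' : Circ n m} {g g' : Circ m k} :
      Eqv f f' → Eqv g g' → Eqv (comp f g) (comp f' g')
  | tensor_congr {n m n' m' : ℕ} {f f' : Circ n m} {g g' : Circ n' m'} :
      Eqv f f' → Eqv g g' → Eqv (tensor f g) (tensor f' g')
  -- category laws
  | id_comp {n m : ℕ} (f : Circ n m) : Eqv (comp (id n) f) f
  | comp_id {n m : ℕ} (f : Circ n m) : Eqv (comp f (id m)) f
  | assoc {n m k l : ℕ} (f : Circ n m) (g : Circ m k) (h : Circ k l) :
      Eqv (comp (comp f g) h) (comp f (comp g h))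
  -- wire crossings compose and juxtapose as bijections do
  | perm_comp {n m k : ℕ} (σ : Fin n ≃ Fin m) (τ : Fin m ≃ Fin k) :
      Eqv (comp (perm σ) (perm τ)) (perm (σ.trans τ))
  | perm_tensor {n m n' m' : ℕ} (σ : Fin n ≃ Fin m) (τ : Fin n' ≃ Fin m') :
      Eqv (tensor (perm σ) (perm τ)) (perm (sumPerm σ τ))
  -- laws of the tensor product: interchange, associativity, units, symmetry
  | interchange {n m k n' m' k' : ℕ} (f : Circ n m) (g : Circ m k) (f' : Circ n' m')
      (g' : Circ m' k') :
      Eqv (tensor (comp f g) (comp f' g')) (comp (tensor f f') (tensor g g'))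
  | tensor_assoc {n m n' m' n'' m'' : ℕ} (f : Circ n m) (g : Circ n' m') (h : Circ n'' m'') :
      Eqv (comp (tensor (tensor f g) h) (perm (finCongr (Nat.add_assoc m m' m''))))
        (comp (perm (finCongr (Nat.add_assoc n n' n''))) (tensor f (tensor g h)))
  | id_tensor {n m : ℕ} (f : Circ n m) :
      Eqv (comp (tensor (id 0) f) (perm (finCongr (Nat.zero_add m))))
        (comp (perm (finCongr (Nat.zero_add n))) f)
  | tensor_id {n m : ℕ} (f : Circ n m) :
      Eqv (comp (tensor f (id 0)) (perm (finCongr (Nat.add_zero m))))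
        (comp (perm (finCongr (Nat.add_zero n))) f)
  | braid {n m n' m' : ℕ} (f : Circ n m) (g : Circ n' m') :
      Eqv (comp (tensor f g) (perm finAddFlip)) (comp (perm finAddFlip) (tensor g f))
  -- a control wire in state `1`
  | tof1 : Eqv (comp (tensor ket1 (id 2)) tof : Circ 2 3) (tensor ket1 cnot)
  | tof1' : Eqv (comp tof (tensor bra1 (id 2)) : Circ 3 2) (tensor bra1 cnot)
  -- a control wire in state `0`
  | tof2 : Eqv (comp (tensor ket0 (id 2)) tof : Circ 2 3) (tensor ket0 (id 2))
  | tof2' : Eqv (comp tof (tensor bra0 (id 2)) : Circ 3 2) (tensor bra0 (id 2))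
  -- gates sharing only their targets, or only controls, commute
  | tof3 : Eqv (comp (tofOn (0 : Fin 5) 1 2) (tofOn 4 3 2))
      (comp (tofOn 4 3 2) (tofOn 0 1 2))
  | tof4 : Eqv (comp (tofOn (2 : Fin 5) 1 0) (tofOn 2 3 4))
      (comp (tofOn 2 3 4) (tofOn 2 1 0))
  | tof5 : Eqv (comp (tofOn (2 : Fin 4) 1 0) (tofOn 1 2 3))
      (comp (tofOn 1 2 3) (tofOn 2 1 0))
  | tof6 : Eqv (comp (tofOn (0 : Fin 4) 2 3) (tofOn 1 2 3))
      (comp (tofOn 1 2 3) (tofOn 0 2 3))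
  -- conjunction of two assertions
  | tof7 : Eqv
      (comp (comp (comp (insertAt ket1 2) (cnotOn (0 : Fin 3) 2)) (removeAt bra0 2))
        (comp (comp (insertAt ket1 2) (cnotOn (1 : Fin 3) 2)) (removeAt bra0 2)))
      (comp (comp (insertAt ket1 2) (tofOn (0 : Fin 3) 1 2)) (removeAt bra0 2))
  -- the zero scalar cuts wires
  | tof8 : Eqv (tensor (comp ket1 bra0) (id 1)) (tensor (comp ket1 bra0) (comp bra1 ket1))
  | tof9 : Eqv (comp ket1 bra1) (id 0)
  | tof10 : Eqv (comp tof tof) (id 3)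
  -- pushing gates past each other
  | tof11 : Eqv (comp (comp (tofOn (1 : Fin 4) 2 3) (tofOn 0 1 2)) (tofOn 1 2 3))
      (comp (tofOn 0 1 3) (tofOn 0 1 2))
  | tof12 : Eqv (comp (comp (cnotOn (0 : Fin 4) 1) (tofOn 1 2 3)) (cnotOn 0 1))
      (comp (tofOn 0 2 3) (tofOn 1 2 3))
  | tof13 : Eqv (comp (comp (tofOn (0 : Fin 4) 1 2) (tofOn 1 2 3)) (tofOn 0 1 2))
      (comp (tofOn 0 1 3) (tofOn 1 2 3))
  | tof14 : Eqv (comp (comp (tofOn (0 : Fin 4) 1 2) (cnotOn 2 3)) (tofOn 0 1 2))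
      (comp (tofOn 0 1 3) (cnotOn 2 3))
  -- three alternating controlled nots swap two wires
  | tof15 : Eqv (comp (comp (cnotOn (0 : Fin 2) 1) (cnotOn 1 0)) (cnotOn 0 1))
      (perm (Equiv.swap (0 : Fin 2) 1))
  -- symmetry of the controls
  | tof16 : Eqv tof
      (comp (comp (perm (Equiv.swap (0 : Fin 3) 1)) tof) (perm (Equiv.swap (0 : Fin 3) 1)))
  | tof17 : Eqv
      (comp (comp (comp (comp (insertAt ket0 2) (tofOn (0 : Fin 5) 1 2)) (tofOn 2 3 4))
        (tofOn 0 1 2)) (removeAt bra0 2))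
      (comp (comp (perm (Equiv.swap (1 : Fin 4) 2))
        (comp (comp (comp (comp (insertAt ket0 2) (tofOn (0 : Fin 5) 1 2)) (tofOn 2 3 4))
          (tofOn 0 1 2)) (removeAt bra0 2)))
        (perm (Equiv.swap (1 : Fin 4) 2)))

/-- Circuits up to equality in `TOF`. -/
instance setoid (n m : ℕ) : Setoid (Circ n m) :=
  ⟨Eqv, ⟨Eqv.refl, Eqv.symm, Eqv.trans⟩⟩

/-- The not gate with `n` controls: wires `0, …, n - 1` are the controls, wire `n` is the target. -/
noncomputable def cnotN : ∀ n : ℕ, Circ (n + 1) (n + 1)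
  | 0 => not
  | 1 => cnot
  | 2 => tof
  | n + 3 =>
    comp (comp (comp (comp (insertAt ket0 (2 : Fin (n + 5)))
      (tof.on (Fin.castLEEmb (Nat.le_add_left 3 (n + 2)))))
      ((cnotN (n + 2)).on (Fin.addNatEmb 2)))
      (tof.on (Fin.castLEEmb (Nat.le_add_left 3 (n + 2)))))
      (removeAt bra0 (2 : Fin (n + 5)))

/-- The wires of a multiply controlled not gate: the controls in increasing order, then the target. -/
def ctrlWires {n : ℕ} (X : Finset (Fin n)) (x : Fin n) (hx : x ∉ X) : Fin (X.card + 1) ↪ Fin n :=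
  ⟨Fin.snoc (α := fun _ => Fin n) (X.orderEmbOfFin rfl) x, by
    rw [Fin.snoc_injective_iff]
    refine ⟨(X.orderEmbOfFin rfl).injective, ?_⟩
    rintro ⟨i, rfl⟩
    exact hx (Finset.orderEmbOfFin_mem X rfl i)⟩

end Circ

/-- The category `TOF`; its objects are the natural numbers. -/
def TOF : Type := ℕ

namespace TOF

/-- The natural number `n` as an object of `TOF`. -/
def of (n : ℕ) : TOF := n

instance : Category TOF where
  Hom n m := Quotient (Circ.setoid n m)
  id n := Quotient.mk _ (Circ.id n)
  comp := Quotient.map₂ Circ.comp fun _ _ h _ _ h' => Circ.Eqv.comp_congr h h'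
  id_comp := by
    rintro n m ⟨f⟩
    exact Quotient.sound (Circ.Eqv.id_comp f)
  comp_id := by
    rintro n m ⟨f⟩
    exact Quotient.sound (Circ.Eqv.comp_id f)
  assoc := by
    rintro n m k l ⟨f⟩ ⟨g⟩ ⟨h⟩
    exact Quotient.sound (Circ.Eqv.assoc f g h)

/-- The map of `TOF` given by a circuit. -/
def mk {n m : ℕ} (f : Circ n m) : of n ⟶ of m := Quotient.mk _ f

open MonoidalCategory

/-- The map of `TOF` given by a bijection of wires. -/
def permIso {n m : ℕ} (σ : Fin n ≃ Fin m) : of n ≅ of m where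
  hom := mk (Circ.perm σ)
  inv := mk (Circ.perm σ.symm)
  hom_inv_id := Quotient.sound ((Circ.Eqv.perm_comp σ σ.symm).trans (by
    rw [Equiv.self_trans_symm]; exact Circ.Eqv.refl _))
  inv_hom_id := Quotient.sound ((Circ.Eqv.perm_comp σ.symm σ).trans (by
    rw [Equiv.symm_trans_self]; exact Circ.Eqv.refl _))

/-- Juxtaposition of maps of `TOF`. -/
def tensorMap {n m n' m' : ℕ} (f : of n ⟶ of m) (g : of n' ⟶ of m') : of (n + n') ⟶ of (m + m') :=
  Quotient.map₂ Circ.tensor (fun _ _ h _ _ h' => Circ.Eqv.tensor_congr h h') f g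

lemma permIso_comp {n m k : ℕ} (σ : Fin n ≃ Fin m) (τ : Fin m ≃ Fin k) :
    (permIso σ).hom ≫ (permIso τ).hom = (permIso (σ.trans τ)).hom :=
  Quotient.sound (Circ.Eqv.perm_comp σ τ)

lemma permIso_tensor {n m n' m' : ℕ} (σ : Fin n ≃ Fin m) (τ : Fin n' ≃ Fin m') :
    tensorMap (permIso σ).hom (permIso τ).hom = (permIso (Circ.sumPerm σ τ)).hom :=
  Quotient.sound (Circ.Eqv.perm_tensor σ τ)

lemma id_eq_permIso (n : ℕ) : 𝟙 (of n) = (permIso (Equiv.refl (Fin n))).hom := rfl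

lemma tensorMap_comp {n m k n' m' k' : ℕ} (f : of n ⟶ of m) (f' : of n' ⟶ of m')
    (g : of m ⟶ of k) (g' : of m' ⟶ of k') :
    tensorMap (f ≫ g) (f' ≫ g') = tensorMap f f' ≫ tensorMap g g' := by
  induction f using Quotient.ind
  induction g using Quotient.ind
  induction f' using Quotient.ind
  induction g' using Quotient.ind
  exact Quotient.sound (Circ.Eqv.interchange _ _ _ _)

lemma tensorMap_id (n m : ℕ) : tensorMap (𝟙 (of n)) (𝟙 (of m)) = 𝟙 (of (n + m)) := by
  rw [id_eq_permIso, id_eq_permIso, id_eq_permIso, permIso_tensor]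
  congr 2
  simp [Circ.sumPerm]

lemma val_sumPerm {n m n' m' : ℕ} (σ : Fin n ≃ Fin m) (τ : Fin n' ≃ Fin m') (i : Fin (n + n')) :
    (Circ.sumPerm σ τ i : ℕ) =
      if h : i.val < n then (σ ⟨i, h⟩ : ℕ) else m + τ ⟨i - n, by omega⟩ := by
  induction i using Fin.addCases with
  | left i => simp [Circ.sumPerm]
  | right i => simp [Circ.sumPerm]

lemma val_finAddFlip {n m : ℕ} (i : Fin (n + m)) :
    (finAddFlip i : ℕ) = if i.val < n then m + i else i - n := by
  induction i using Fin.addCases with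
  | left i => simp
  | right i => simp

lemma pentagon_aux (a b c d : ℕ) :
    tensorMap (permIso (finCongr (Nat.add_assoc a b c))).hom (𝟙 (of d)) ≫
      (permIso (finCongr (Nat.add_assoc a (b + c) d))).hom ≫
      tensorMap (𝟙 (of a)) (permIso (finCongr (Nat.add_assoc b c d))).hom =
    (permIso (finCongr (Nat.add_assoc (a + b) c d))).hom ≫
      (permIso (finCongr (Nat.add_assoc a b (c + d)))).hom := by
  rw [id_eq_permIso, id_eq_permIso, permIso_tensor, permIso_tensor, permIso_comp, permIso_comp,
    permIso_comp]
  congr 2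
  ext i
  simp [val_sumPerm]
  grind

lemma triangle_aux (a b : ℕ) :
    (permIso (finCongr (Nat.add_assoc a 0 b))).hom ≫
      tensorMap (𝟙 (of a)) (permIso (finCongr (Nat.zero_add b))).hom =
    tensorMap (permIso (finCongr (Nat.add_zero a))).hom (𝟙 (of b)) := by
  rw [id_eq_permIso, id_eq_permIso, permIso_tensor, permIso_tensor, permIso_comp]
  congr 2
  ext i
  simp [val_sumPerm]

lemma hexagon_aux (a b c : ℕ) :
    (permIso (finCongr (Nat.add_assoc a b c))).hom ≫
      (permIso (finAddFlip (m := a) (n := b + c))).hom ≫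
      (permIso (finCongr (Nat.add_assoc b c a))).hom =
    tensorMap (permIso (finAddFlip (m := a) (n := b))).hom (𝟙 (of c)) ≫
      (permIso (finCongr (Nat.add_assoc b a c))).hom ≫
      tensorMap (𝟙 (of b)) (permIso (finAddFlip (m := a) (n := c))).hom := by
  rw [id_eq_permIso, id_eq_permIso, permIso_tensor, permIso_tensor, permIso_comp, permIso_comp,
    permIso_comp, permIso_comp]
  congr 2
  ext i
  simp [val_sumPerm, val_finAddFlip]
  grind

lemma hexagon_aux' (a b c : ℕ) :
    (permIso (finCongr (Nat.add_assoc a b c))).inv ≫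
      (permIso (finAddFlip (m := a + b) (n := c))).hom ≫
      (permIso (finCongr (Nat.add_assoc c a b))).inv =
    tensorMap (𝟙 (of a)) (permIso (finAddFlip (m := b) (n := c))).hom ≫
      (permIso (finCongr (Nat.add_assoc a c b))).inv ≫
      tensorMap (permIso (finAddFlip (m := a) (n := c))).hom (𝟙 (of b)) := by
  change (permIso (Equiv.symm _)).hom ≫ _ ≫ (permIso (Equiv.symm _)).hom =
    _ ≫ (permIso (Equiv.symm _)).hom ≫ _
  rw [id_eq_permIso, id_eq_permIso, permIso_tensor, permIso_tensor, permIso_comp, permIso_comp,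
    permIso_comp, permIso_comp]
  congr 2
  ext i
  simp [val_sumPerm, val_finAddFlip]
  grind

lemma symmetry_aux (a b : ℕ) :
    (permIso (finAddFlip (m := a) (n := b))).hom ≫ (permIso (finAddFlip (m := b) (n := a))).hom =
      𝟙 (of (a + b)) := by
  rw [id_eq_permIso, permIso_comp]
  congr 2
  ext i
  simp [val_finAddFlip]
  grind

instance : MonoidalCategoryStruct TOF where
  tensorObj n m := Nat.add n m
  tensorUnit := of 0
  tensorHom f g := tensorMap f g
  whiskerLeft n _ _ f := tensorMap (𝟙 n) f
  whiskerRight f n := tensorMap f (𝟙 n)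
  associator n m k := permIso (finCongr (Nat.add_assoc n m k))
  leftUnitor n := permIso (finCongr (Nat.zero_add n))
  rightUnitor n := permIso (finCongr (Nat.add_zero n))

instance : MonoidalCategory TOF := MonoidalCategory.ofTensorHom
  (id_tensorHom_id := tensorMap_id)
  (id_tensorHom := fun _ _ _ _ => rfl)
  (tensorHom_id := fun _ _ => rfl)
  (tensorHom_comp_tensorHom := fun f g h k => (tensorMap_comp f g h k).symm)
  (associator_naturality := by
    rintro _ _ _ _ _ _ ⟨f⟩ ⟨g⟩ ⟨h⟩
    exact Quotient.sound (Circ.Eqv.tensor_assoc f g h))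
  (leftUnitor_naturality := by
    rintro _ _ ⟨f⟩
    exact Quotient.sound (Circ.Eqv.id_tensor f))
  (rightUnitor_naturality := by
    rintro _ _ ⟨f⟩
    exact Quotient.sound (Circ.Eqv.tensor_id f))
  (pentagon := pentagon_aux)
  (triangle := triangle_aux)

instance : SymmetricCategory TOF where
  braiding n m := permIso (finAddFlip (m := n) (n := m))
  braiding_naturality_left := by
    rintro (n : ℕ) (m : ℕ) ⟨f⟩ (k : ℕ)
    exact Quotient.sound (Circ.Eqv.braid f (Circ.id k))
  braiding_naturality_right := by
    rintro (k : ℕ) (n : ℕ) (m : ℕ) ⟨f⟩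
    exact Quotient.sound (Circ.Eqv.braid (Circ.id k) f)
  hexagon_forward := hexagon_aux
  hexagon_reverse := hexagon_aux'
  symmetry := symmetry_aux

/-- `⊕_x^X`: the not gate on the wire `x` of an `n`-wire circuit, controlled by the wires in `X`. -/
noncomputable def mcx {n : ℕ} (X : Finset (Fin n)) (x : Fin n) (hx : x ∉ X) : of n ⟶ of n :=
  mk ((Circ.cnotN X.card).on (Circ.ctrlWires X x hx))

/-- `▷_x`: the ancilla `|0⟩` on the wire `x`, which is thereby added to the other `n` wires. -/
def zeroKet {n : ℕ} (x : Fin (n + 1)) : of n ⟶ of (n + 1) := mk (Circ.insertAt Circ.ket0 x)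

end TOF

/-!
If a circuit preserves a fixed state of one of its wires, then it restricts to a circuit on the
other wires, and this restriction is determined by the product of the circuit with the projection
of the wire onto the state. Hence an identity between circuits with an additional wire descends to
their restrictions. Two kinds of additional wires suffice. A wire in the state `|1⟩` is a dummy
control. A wire in the state `|0⟩` merges two controls into one, if the circuit is conjugated with
the Toffoli gate that targets this wire; this works for any two of the controls because the gates
are symmetric in their controls, which follows from the symmetry of the gate with three controls.
All of the identities thereby reduce to gates with at most two controls, where they are among the
relations of `TOF`. Identity (vi) is the conjugation rule (v) for `X = {x}`, as a wire in the state
`|0⟩` removes the gates that it controls.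
-/

namespace TOF

section Monoid

variable {M : Type*} [Monoid M] {c d f f' g h k l p s t u : M}

lemma conj_mul_conj (ht : t * t = 1) :
    t * f * t * (t * g * t) = t * (f * g) * t := by
  calc t * f * t * (t * g * t) = t * f * (t * t) * g * t := by simp only [mul_assoc]
    _ = t * (f * g) * t := by rw [ht, mul_one]; simp only [mul_assoc]

lemma commute_conj_of_conj_eq_mul (ht : t * t = 1)
    (h : t * c * t = d * c) (hc : Commute g c) (hd : Commute g d) : Commute c (t * g * t) := by
  have hct : c * t = t * (d * c) := by rw [← h, ← mul_assoc, ← mul_assoc, ht, one_mul]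
  have htc : d * c * t = t * c := by rw [← h, mul_assoc, ht, mul_one]
  calc c * (t * g * t) = c * t * g * t := by simp only [mul_assoc]
    _ = t * (d * c * g) * t := by rw [hct, mul_assoc t]
    _ = t * g * (d * c * t) := by rw [← (hd.mul_right hc).eq]; simp only [mul_assoc]
    _ = t * g * t * c := by rw [htc]; simp only [mul_assoc]

lemma mul_conj_congr (ht : Commute p t) (h : p * f = p * f') :
    p * (t * f * t) = p * (t * f' * t) := by
  rw [mul_assoc t, mul_assoc t, ht.left_comm, ht.left_comm, ← mul_assoc p, ← mul_assoc p, h]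

lemma mul_conj_eq_of_mul_eq_mul_conj (ht : t * t = 1) (hp : Commute p (k * g))
    (hk : p * k = p * (t * s * t)) (htg : Commute t g) :
    p * (k * g * k) = p * (t * (s * g * s) * t) := by
  calc p * (k * g * k) = k * g * (p * k) := hp.left_comm k
    _ = p * (k * g) * (t * s * t) := by rw [hk, hp.eq, mul_assoc (k * g)]
    _ = p * k * g * (t * s * t) := by rw [← mul_assoc p]
    _ = p * (t * s * (t * g) * t * s * t) := by rw [hk]; simp only [mul_assoc]
    _ = p * (t * (s * g * (t * t) * s) * t) := by rw [htg.eq]; simp only [mul_assoc]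
    _ = p * (t * (s * g * s) * t) := by rw [ht, mul_one]

lemma conj_conj_of_conj_eq_mul (ht : t * t = 1) (hth : Commute t h) (hl : l * h * l = k * h) :
    t * l * t * h * (t * l * t) = t * k * t * h := by
  calc t * l * t * h * (t * l * t) = t * l * (t * h) * t * l * t := by simp only [mul_assoc]
    _ = t * (l * h * (t * t) * l) * t := by rw [hth.eq]; simp only [mul_assoc]
    _ = t * k * (h * t) := by rw [ht, mul_one, hl]; simp only [mul_assoc]
    _ = t * k * t * h := by rw [← hth.eq, ← mul_assoc]

lemma conj_conj_eq_mul_conj (hc : c * c = 1) (ht : c * t * c = u * t) (htu : Commute t u)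
    (hcg : Commute c g) (hu : u * g * u = k * g) (htk : Commute t k) :
    c * (t * g * t) * c = k * (t * g * t) := by
  calc c * (t * g * t) * c = c * t * (c * c) * g * t * c := by
        rw [hc]; simp only [mul_assoc, mul_one]
    _ = (c * t * c) * (c * g) * t * c := by simp only [mul_assoc]
    _ = (c * t * c) * g * (c * t * c) := by rw [hcg.eq]; simp only [mul_assoc]
    _ = (t * u) * g * (u * t) := by rw [ht, htu.eq]
    _ = t * (u * g * u) * t := by simp only [mul_assoc]
    _ = k * (t * g * t) := by rw [hu, ← mul_assoc, htk.eq]; simp only [mul_assoc]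

end Monoid

/-! ### Circuits placed on wires -/

lemma permIso_trans {n m k : ℕ} (σ : Fin n ≃ Fin m) (τ : Fin m ≃ Fin k) :
    permIso (σ.trans τ) = permIso σ ≪≫ permIso τ :=
  Iso.ext (permIso_comp σ τ).symm

lemma tensorMap_comp_id {n m k : ℕ} (l : ℕ) (f : of n ⟶ of m) (g : of m ⟶ of k) :
    tensorMap (f ≫ g) (𝟙 (of l)) = tensorMap f (𝟙 (of l)) ≫ tensorMap g (𝟙 (of l)) :=
  MonoidalCategory.comp_whiskerRight f g (of l)

lemma tensorMap_id_comp {n m k : ℕ} (l : ℕ) (f : of n ⟶ of m) (g : of m ⟶ of k) :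
    tensorMap (𝟙 (of l)) (f ≫ g) = tensorMap (𝟙 (of l)) f ≫ tensorMap (𝟙 (of l)) g :=
  MonoidalCategory.whiskerLeft_comp (of l) f g

lemma tensorMap_exchange {n m n' m' : ℕ} (f : of n ⟶ of m) (g : of n' ⟶ of m') :
    tensorMap (𝟙 (of n)) g ≫ tensorMap f (𝟙 (of m')) =
      tensorMap f (𝟙 (of n')) ≫ tensorMap (𝟙 (of m)) g :=
  MonoidalCategory.whisker_exchange f g

lemma tensorMap_id_zero {n m : ℕ} (f : of n ⟶ of m) : tensorMap f (𝟙 (of 0)) = f :=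
  (Category.comp_id _).symm.trans
    ((MonoidalCategory.rightUnitor_naturality f).trans (Category.id_comp f))

lemma id_zero_tensorMap (f : of 1 ⟶ of 1) : tensorMap (𝟙 (of 0)) f = f :=
  (Category.comp_id _).symm.trans
    ((MonoidalCategory.leftUnitor_naturality f).trans (Category.id_comp f))

lemma tensorMap_finAddFlip {n m n' m' : ℕ} (f : of n ⟶ of m) (g : of n' ⟶ of m') :
    tensorMap f g ≫ (permIso finAddFlip).hom = (permIso finAddFlip).hom ≫ tensorMap g f :=
  BraidedCategory.braiding_naturality f g

/-- The circuits with `n` input and `n` output wires, up to equality in `TOF`. Products are taken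
in diagrammatic order, opposite to that of `CategoryTheory.End`. -/
abbrev Op (n : ℕ) : Type := of n ⟶ of n

instance (n : ℕ) : Monoid (Op n) where
  mul f g := f ≫ g
  one := 𝟙 (of n)
  mul_assoc f g h := Category.assoc f g h
  one_mul f := Category.id_comp f
  mul_one f := Category.comp_id f

lemma Op.mul_def {n : ℕ} (f g : Op n) : f * g = f ≫ g := rfl

lemma Op.one_def (n : ℕ) : (1 : Op n) = 𝟙 (of n) := rfl

lemma wireEquiv_castAdd {k n : ℕ} (w : Fin k ↪ Fin n) (i : Fin k) :
    Circ.wireEquiv w (Fin.castAdd _ i) = w i := by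
  simp only [Circ.wireEquiv, Equiv.trans_apply, finSumFinEquiv_symm_apply_castAdd,
    Equiv.sumCongr_apply, Sum.map_inl, Equiv.sumCompl_apply_inl]
  rfl

lemma conj_sumPerm_tensorMap {k m p q : ℕ} (σ : Fin k ≃ Fin m) (τ : Fin p ≃ Fin q) (f : Op k) :
    (permIso (Circ.sumPerm σ τ)).conj (tensorMap f (𝟙 (of p))) =
      tensorMap ((permIso σ).conj f) (𝟙 (of q)) := by
  have inv_eq : (permIso (Circ.sumPerm σ τ)).inv = tensorMap (permIso σ).inv (permIso τ).inv :=
    (permIso_tensor σ.symm τ.symm).symm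
  rw [Iso.conj_apply, inv_eq, ← permIso_tensor, ← tensorMap_comp, ← tensorMap_comp,
    Category.id_comp, Iso.inv_hom_id, Iso.conj_apply]

lemma exists_eq_sumPerm {k m m' : ℕ} (ρ : Fin (k + m) ≃ Fin (k + m'))
    (h : ∀ i, ρ (Fin.castAdd m i) = Fin.castAdd m' i) :
    ∃ τ : Fin m ≃ Fin m', ρ = Circ.sumPerm (Equiv.refl _) τ := by
  obtain rfl : m = m' := by simpa using Fintype.card_congr ρ
  obtain ⟨⟨σ, τ⟩, hστ⟩ := Equiv.Perm.mem_sumCongrHom_range_of_perm_mapsTo_inl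
    (σ := (finSumFinEquiv.trans ρ).trans finSumFinEquiv.symm) (by
      rintro _ ⟨i, rfl⟩
      exact ⟨i, by simp [h]⟩)
  have hρ : ρ = Circ.sumPerm σ τ := by
    ext i : 1
    have := congrArg finSumFinEquiv (Equiv.congr_fun hστ (finSumFinEquiv.symm i))
    simpa [Circ.sumPerm] using this.symm
  obtain rfl : σ = Equiv.refl _ := by
    ext i : 1
    simpa [hρ, Circ.sumPerm] using h i
  exact ⟨τ, hρ⟩

/-- A circuit on `k` wires placed on the wires `e 0, …, e (k - 1)` of a circuit with `n` wires. -/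
noncomputable def place {k n : ℕ} (e : Fin k ↪ Fin n) : Op k →* Op n where
  toFun f := (permIso (Circ.wireEquiv e)).conj (tensorMap f (𝟙 (of (n - k))))
  map_one' := by rw [Op.one_def, tensorMap_id, Iso.conj_id, Op.one_def]
  map_mul' f g := by rw [Op.mul_def, tensorMap_comp_id, Iso.conj_comp, Op.mul_def]

lemma mk_on {k n : ℕ} (g : Circ k k) (e : Fin k ↪ Fin n) : mk (g.on e) = place e (mk g) :=
  Category.assoc (mk _) (mk _) (mk _)

lemma place_eq_conj {k m n : ℕ} (e : Fin k ↪ Fin n) (σ : Fin (k + m) ≃ Fin n)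
    (h : ∀ i, σ (Fin.castAdd m i) = e i) (f : Op k) :
    place e f = (permIso σ).conj (tensorMap f (𝟙 (of m))) := by
  obtain ⟨τ, hτ⟩ := exists_eq_sumPerm (σ.trans (Circ.wireEquiv e).symm) (fun i => by
    rw [Equiv.trans_apply, h, Equiv.symm_apply_eq, wireEquiv_castAdd])
  have hσ : σ = (Circ.sumPerm (Equiv.refl _) τ).trans (Circ.wireEquiv e) := by
    rw [← hτ, Equiv.trans_assoc, Equiv.symm_trans_self, Equiv.trans_refl]
  rw [hσ, permIso_trans, Iso.trans_conj, conj_sumPerm_tensorMap]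
  exact congrArg (fun g : Op k => (permIso (Circ.wireEquiv e)).conj (tensorMap g _))
    (Iso.refl_conj f).symm

lemma place_toEmbedding {n : ℕ} (σ : Fin n ≃ Fin n) (f : Op n) :
    place σ.toEmbedding f = (permIso σ).conj f := by
  rw [place_eq_conj (m := 0) σ.toEmbedding σ (fun i => rfl), tensorMap_id_zero]

lemma place_castAddEmb {k : ℕ} (m : ℕ) (f : Op k) :
    place (Fin.castAddEmb m) f = tensorMap f (𝟙 (of m)) := by
  rw [place_eq_conj (Fin.castAddEmb m) (Equiv.refl _) (fun i => rfl)]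
  exact Iso.refl_conj _

lemma place_natAddEmb {k : ℕ} (m : ℕ) (f : Op k) :
    place (Fin.natAddEmb m) f = tensorMap (𝟙 (of m)) f := by
  rw [place_eq_conj (Fin.natAddEmb m) finAddFlip (fun i => by simp), Iso.conj_apply,
    tensorMap_finAddFlip, Iso.inv_hom_id_assoc]

lemma tensorMap_tensorMap_id {k : ℕ} (m n : ℕ) (f : Op k) :
    tensorMap (tensorMap f (𝟙 (of m))) (𝟙 (of n)) =
      (permIso (finCongr (Nat.add_assoc k m n)).symm).conj (tensorMap f (𝟙 (of (m + n)))) := by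
  rw [Iso.conj_apply, ← tensorMap_id]
  exact ((Iso.eq_comp_inv (permIso (finCongr (Nat.add_assoc k m n)))).2
    (MonoidalCategory.associator_naturality f (𝟙 (of m)) (𝟙 (of n)))).trans (Category.assoc _ _ _)

lemma place_place {k m n : ℕ} (e : Fin k ↪ Fin m) (e' : Fin m ↪ Fin n) (f : Op k) :
    place e' (place e f) = place (e.trans e') f := by
  rw [place_eq_conj (e.trans e') ((finCongr (Nat.add_assoc k (m - k) (n - m))).symm.trans
    ((Circ.sumPerm (Circ.wireEquiv e) (Equiv.refl (Fin (n - m)))).trans (Circ.wireEquiv e')))]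
  · rw [permIso_trans, permIso_trans, Iso.trans_conj, Iso.trans_conj, ← tensorMap_tensorMap_id,
      conj_sumPerm_tensorMap]
    rfl
  · intro i
    change Circ.wireEquiv e' (Circ.sumPerm (Circ.wireEquiv e) (Equiv.refl _)
      (Fin.castAdd (n - m) (Fin.castAdd (m - k) i))) = _
    simp [Circ.sumPerm, wireEquiv_castAdd]

lemma place_commute {k l n : ℕ} (e : Fin k ↪ Fin n) (e' : Fin l ↪ Fin n)
    (h : ∀ i j, e i ≠ e' j) (f : Op k) (g : Op l) : Commute (place e f) (place e' g) := by
  let E : Fin (k + l) ↪ Fin n := ⟨Fin.append e e',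
    Fin.append_injective_iff.2 ⟨e.injective, e'.injective, h⟩⟩
  have he : (Fin.castAddEmb l).trans E = e := by ext i : 1; simp [E]
  have he' : (Fin.natAddEmb k).trans E = e' := by ext i : 1; simp [E]
  rw [← he, ← he', ← place_place, ← place_place, place_castAddEmb, place_natAddEmb]
  exact Commute.map (tensorMap_exchange f g).symm (place E)

/-! ### Ancillae -/

lemma lastTo_castAdd {n : ℕ} (z : Fin (n + 1)) (i : Fin n) :
    Circ.lastTo z (Fin.castAdd 1 i) = z.succAbove i := by
  have h : Fin.castAdd 1 i = (Fin.last n).succAbove i := (Fin.succAbove_last_apply i).symm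
  rw [Circ.lastTo, Equiv.trans_apply, h, finSuccEquiv'_succAbove, finSuccEquiv'_symm_some]

lemma lastTo_last {n : ℕ} (z : Fin (n + 1)) : Circ.lastTo z (Fin.last n) = z := by
  rw [Circ.lastTo, Equiv.trans_apply, finSuccEquiv'_at, finSuccEquiv'_symm_none]

/-- The inclusion of the wire `z`, for placing circuits on one wire. -/
def single {n : ℕ} (z : Fin n) : Fin 1 ↪ Fin n := ⟨fun _ => z, fun i j _ => Subsingleton.elim i j⟩

lemma single_trans {n m : ℕ} (z : Fin n) (e : Fin n ↪ Fin m) :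
    (single z).trans e = single (e z) := rfl

/-- The extension of an inclusion of wires by a new wire, which is inserted in position `z` into the
first circuit and in position `z'` into the second one. -/
def insertWire {n m : ℕ} (z : Fin (n + 1)) (z' : Fin (m + 1)) (e : Fin n ↪ Fin m) :
    Fin (n + 1) ↪ Fin (m + 1) :=
  ((finSuccEquiv' z).toEmbedding.trans e.optionMap).trans (finSuccEquiv' z').symm.toEmbedding

lemma insertWire_self {n m : ℕ} (z : Fin (n + 1)) (z' : Fin (m + 1)) (e : Fin n ↪ Fin m) :
    insertWire z z' e z = z' := by
  simp [insertWire]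

lemma insertWire_succAbove {n m : ℕ} (z : Fin (n + 1)) (z' : Fin (m + 1)) (e : Fin n ↪ Fin m)
    (i : Fin n) : insertWire z z' e (z.succAbove i) = z'.succAbove (e i) := by
  simp [insertWire]

lemma succAboveEmb_trans_insertWire {n m : ℕ} (z : Fin (n + 1)) (z' : Fin (m + 1))
    (e : Fin n ↪ Fin m) :
    z.succAboveEmb.trans (insertWire z z' e) = e.trans z'.succAboveEmb :=
  Function.Embedding.ext (insertWire_succAbove z z' e)

/-- A state of a wire: an input ancilla with the output ancilla that detects it. -/
structure Ancilla where
  ket : of 0 ⟶ of 1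
  bra : of 1 ⟶ of 0
  ket_bra : ket ≫ bra = 𝟙 (of 0)

namespace Ancilla

variable (s : Ancilla) {n m : ℕ}

/-- Creation of a new wire in position `z`, in the state `s`. -/
def create (z : Fin (n + 1)) : of n ⟶ of (n + 1) :=
  tensorMap (𝟙 (of n)) s.ket ≫ (permIso (Circ.lastTo z)).hom

/-- Termination of the wire in position `z`, in the state `s`. -/
def terminate (z : Fin (n + 1)) : of (n + 1) ⟶ of n :=
  (permIso (Circ.lastTo z)).inv ≫ tensorMap (𝟙 (of n)) s.bra

/-- The projection of the wire `z` onto the state `s`. -/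
noncomputable def proj (z : Fin n) : Op n := place (single z) (s.bra ≫ s.ket)

/-- The circuit `F` with its wire `z` reduced to an auxiliary wire that enters and leaves in the
state `s`. -/
def compress (z : Fin (n + 1)) (F : Op (n + 1)) : Op n := s.create z ≫ F ≫ s.terminate z

/-- The circuit `F` leaves the wire `z` in the state `s` if it enters in this state, and then acts
as `f` on the other wires. -/
def RestrictsTo (z : Fin (n + 1)) (F : Op (n + 1)) (f : Op n) : Prop :=
  s.create z ≫ F = f ≫ s.create z

lemma create_terminate (z : Fin (n + 1)) : s.create z ≫ s.terminate z = 𝟙 (of n) := by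
  rw [create, terminate, Category.assoc, Iso.hom_inv_id_assoc, ← tensorMap_id_comp, s.ket_bra,
    tensorMap_id_zero]

lemma terminate_create (z : Fin (n + 1)) : s.terminate z ≫ s.create z = s.proj z := by
  rw [proj, place_eq_conj (single z) ((finAddFlip : Fin (1 + n) ≃ Fin (n + 1)).trans
    (Circ.lastTo z)), permIso_trans, Iso.trans_conj]
  · rw [Iso.conj_apply (permIso finAddFlip), tensorMap_finAddFlip, Iso.inv_hom_id_assoc,
      Iso.conj_apply, tensorMap_id_comp, terminate, create]
    simp only [Category.assoc]
  · intro i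
    have h : Fin.natAdd n i = Fin.last n := by ext; simp
    rw [Equiv.trans_apply, finAddFlip_apply_castAdd, h, lastTo_last]
    rfl

lemma create_proj (z : Fin (n + 1)) : s.create z ≫ s.proj z = s.create z := by
  rw [← terminate_create, ← Category.assoc, create_terminate, Category.id_comp]

lemma isIdempotentElem_proj (z : Fin n) : IsIdempotentElem (s.proj z) := by
  rw [IsIdempotentElem, proj, ← map_mul, Op.mul_def, Category.assoc, ← Category.assoc s.ket,
    s.ket_bra, Category.id_comp]

lemma proj_zero (k : ℕ) : s.proj (0 : Fin (1 + k)) = tensorMap (s.bra ≫ s.ket) (𝟙 (of k)) := by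
  have h : single (0 : Fin (1 + k)) = Fin.castAddEmb k := by
    ext i
    fin_cases i
    rfl
  rw [proj, h, place_castAddEmb]

lemma place_proj (e : Fin n ↪ Fin m) (z : Fin n) : place e (s.proj z) = s.proj (e z) := by
  rw [proj, place_place, single_trans, proj]

lemma restrictsTo_place (z : Fin (n + 1)) (f : Op n) :
    s.RestrictsTo z (place z.succAboveEmb f) f := by
  rw [RestrictsTo, place_eq_conj z.succAboveEmb (Circ.lastTo z) (lastTo_castAdd z), Iso.conj_apply,
    create, Category.assoc, Iso.hom_inv_id_assoc, ← Category.assoc, ← Category.assoc,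
    tensorMap_exchange, tensorMap_id_zero]

variable {s} {z : Fin (n + 1)} {F G : Op (n + 1)} {f g : Op n}

lemma restrictsTo_iff :
    s.RestrictsTo z F f ↔ s.proj z * F = s.proj z * place z.succAboveEmb f := by
  have h : s.RestrictsTo z F f ↔ s.create z ≫ F = s.create z ≫ place z.succAboveEmb f := by
    rw [restrictsTo_place s z f, RestrictsTo]
  rw [h]
  constructor <;> intro h
  · rw [← terminate_create, Op.mul_def, Op.mul_def, Category.assoc, h, Category.assoc]
  · rw [← create_proj, Category.assoc, Category.assoc]
    exact congrArg (s.create z ≫ ·) h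

lemma RestrictsTo.mul (hF : s.RestrictsTo z F f) (hG : s.RestrictsTo z G g) :
    s.RestrictsTo z (F * G) (f * g) := by
  rw [RestrictsTo, Op.mul_def, Op.mul_def, ← Category.assoc, hF, Category.assoc, hG,
    Category.assoc]

lemma restrictsTo_one : s.RestrictsTo z 1 1 :=
  (Category.comp_id _).trans (Category.id_comp _).symm

lemma RestrictsTo.compress_eq (h : s.RestrictsTo z F f) : s.compress z F = f := by
  rw [compress, ← Category.assoc, h, Category.assoc, create_terminate, Category.comp_id]

lemma RestrictsTo.unique (hf : s.RestrictsTo z F f) (hg : s.RestrictsTo z F g) : f = g :=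
  hf.compress_eq.symm.trans hg.compress_eq

lemma RestrictsTo.commute (hF : s.RestrictsTo z F f) (hG : s.RestrictsTo z G g)
    (h : Commute F G) : Commute f g := by
  have hFG := hF.mul hG
  rw [h.eq] at hFG
  exact hFG.unique (hG.mul hF)

lemma proj_mul_place_compress (z : Fin (n + 1)) (F : Op (n + 1)) :
    s.proj z * place z.succAboveEmb (s.compress z F) = s.proj z * F * s.proj z := by
  rw [← terminate_create, Op.mul_def, Op.mul_def, Op.mul_def, Category.assoc,
    s.restrictsTo_place z, compress]
  simp only [Category.assoc]

lemma restrictsTo_compress (h : s.proj z * F * s.proj z = s.proj z * F) :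
    s.RestrictsTo z F (s.compress z F) := by
  rw [restrictsTo_iff, proj_mul_place_compress, h]

lemma eq_of_proj_mul_place_eq
    (h : s.proj z * place z.succAboveEmb f = s.proj z * place z.succAboveEmb g) : f = g :=
  (s.restrictsTo_place z f).unique (restrictsTo_iff.2 h)

lemma commute_proj_place {k : ℕ} {w : Fin n} {e : Fin k ↪ Fin n} (h : ∀ i, w ≠ e i) (f : Op k) :
    Commute (s.proj w) (place e f) :=
  place_commute _ _ (fun _ => h) _ _

lemma commute_compress (h : Commute F (place z.succAboveEmb g)) : Commute (s.compress z F) g := by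
  have hz : Commute (s.proj z) (place z.succAboveEmb g) :=
    commute_proj_place (fun i => Fin.ne_succAbove z i) g
  apply eq_of_proj_mul_place_eq (s := s) (z := z)
  rw [map_mul, map_mul, ← mul_assoc, ← mul_assoc, proj_mul_place_compress, hz.eq,
    mul_assoc (place _ g), proj_mul_place_compress]
  exact (hz.mul_left h).mul_left hz

lemma place_compress (e : Fin n ↪ Fin m) (z : Fin (n + 1)) (z' : Fin (m + 1)) (F : Op (n + 1)) :
    place e (s.compress z F) = s.compress z' (place (insertWire z z' e) F) := by
  apply eq_of_proj_mul_place_eq (s := s) (z := z')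
  have h := congrArg (place (insertWire z z' e)) (s.proj_mul_place_compress z F)
  rw [map_mul, map_mul, map_mul, place_proj, insertWire_self, place_place,
    succAboveEmb_trans_insertWire] at h
  rw [place_place, h, proj_mul_place_compress]

lemma proj_zero_mul_of_ket_comp {k : ℕ} {F : Op (1 + k)} {f : Op k}
    (h : tensorMap s.ket (𝟙 (of k)) ≫ F = tensorMap s.ket f) :
    s.proj 0 * F = s.proj 0 * place (Fin.natAddEmb 1) f := by
  rw [proj_zero, place_natAddEmb, Op.mul_def, Op.mul_def, tensorMap_comp_id, Category.assoc, h,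
    ← tensorMap_comp, ← tensorMap_comp_id, ← tensorMap_comp, Category.comp_id, Category.id_comp]

lemma mul_proj_zero_of_comp_bra {k : ℕ} {F : Op (1 + k)} {f : Op k}
    (h : F ≫ tensorMap s.bra (𝟙 (of k)) = tensorMap s.bra f) :
    F * s.proj 0 = place (Fin.natAddEmb 1) f * s.proj 0 := by
  rw [proj_zero, place_natAddEmb, Op.mul_def, Op.mul_def, tensorMap_comp_id, ← Category.assoc, h,
    ← tensorMap_comp, ← tensorMap_comp_id, ← tensorMap_comp, Category.comp_id, Category.id_comp]

lemma proj_zero_mul_mul_proj_zero {k : ℕ} {F : Op (1 + k)} {f : Op k}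
    (h : tensorMap s.ket (𝟙 (of k)) ≫ F ≫ tensorMap s.bra (𝟙 (of k)) = tensorMap (𝟙 (of 0)) f) :
    s.proj 0 * F * s.proj 0 = s.proj 0 * place (Fin.natAddEmb 1) f := by
  rw [proj_zero, place_natAddEmb, Op.mul_def, Op.mul_def, Op.mul_def, ← tensorMap_comp,
    Category.comp_id, Category.id_comp, tensorMap_comp_id]
  calc ((tensorMap s.bra (𝟙 _) ≫ tensorMap s.ket (𝟙 _)) ≫ F) ≫
        tensorMap s.bra (𝟙 _) ≫ tensorMap s.ket (𝟙 _)
      = tensorMap s.bra (𝟙 _) ≫ (tensorMap s.ket (𝟙 _) ≫ F ≫ tensorMap s.bra (𝟙 _)) ≫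
        tensorMap s.ket (𝟙 _) := by simp only [Category.assoc]
    _ = tensorMap (s.bra ≫ s.ket) f := by
      rw [h, ← tensorMap_comp, ← tensorMap_comp, Category.id_comp, Category.id_comp,
        Category.comp_id]

end Ancilla

/-! ### Gates with a list of controls -/

variable {n m : ℕ} {a b c d x y z w : Fin n} {l l' : List (Fin n)}

open scoped Classical in
/-- The not gate with target `x` and with the list `l` of controls, in this order; it is taken to be
the identity if these wires are not distinct. -/
noncomputable def cnotList (l : List (Fin n)) (x : Fin n) : Op n :=
  if h : Function.Injective (Fin.snoc (α := fun _ => Fin n) l.get x) then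
    place ⟨_, h⟩ (mk (Circ.cnotN l.length)) else 1

lemma injective_snoc_get_iff :
    Function.Injective (Fin.snoc (α := fun _ => Fin n) l.get x) ↔ l.Nodup ∧ x ∉ l := by
  rw [Fin.snoc_injective_iff, List.nodup_iff_injective_get]
  simp only [Set.mem_range, List.mem_iff_get]

lemma cnotList_eq_one (h : ¬(l.Nodup ∧ x ∉ l)) : cnotList l x = 1 := by
  rw [cnotList, dif_neg (mt injective_snoc_get_iff.1 h)]

lemma cnotList_eq_place {k : ℕ} (l : List (Fin n)) (x : Fin n) (w : Fin (k + 1) ↪ Fin n)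
    (hk : l.length = k) (hl : ∀ i : Fin k, w i.castSucc = l.get (i.cast hk.symm))
    (hx : w (Fin.last k) = x) : cnotList l x = place w (mk (Circ.cnotN k)) := by
  subst hk
  have hw : (w : Fin (l.length + 1) → Fin n) = Fin.snoc (α := fun _ => Fin n) l.get x := by
    funext i
    induction i using Fin.lastCases with
    | last => rw [hx, Fin.snoc_last]
    | cast i => rw [hl, Fin.snoc_castSucc]; rfl
  rw [cnotList, dif_pos (hw ▸ w.injective)]
  congr 2
  ext i : 1
  exact (congrFun hw i).symm

lemma place_cnotList (e : Fin n ↪ Fin m) (l : List (Fin n)) (x : Fin n) :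
    place e (cnotList l x) = cnotList (l.map e) (e x) := by
  by_cases h : l.Nodup ∧ x ∉ l
  · rw [cnotList, dif_pos (injective_snoc_get_iff.2 h), place_place]
    exact (cnotList_eq_place _ _ _ (by simp) (fun i => by simp) (by simp)).symm
  · rw [cnotList_eq_one h, map_one, cnotList_eq_one]
    rintro ⟨h1, h2⟩
    exact h ⟨h1.of_map, fun hx => h2 (List.mem_map_of_mem hx)⟩

lemma mk_tofOn (h : Function.Injective ![a, b, c]) :
    mk (Circ.tofOn a b c h) = cnotList [a, b] c :=
  (mk_on _ _).trans
    (cnotList_eq_place (k := 2) _ _ ⟨_, h⟩ rfl (fun i => by fin_cases i <;> rfl) rfl).symm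

lemma mk_cnotOn (h : Function.Injective ![a, c]) : mk (Circ.cnotOn a c h) = cnotList [a] c :=
  (mk_on _ _).trans
    (cnotList_eq_place (k := 1) _ _ ⟨_, h⟩ rfl (fun i => by fin_cases i; rfl) rfl).symm

lemma mk_tof : mk Circ.tof = cnotList [(0 : Fin 3), 1] 2 := by
  rw [cnotList_eq_place (k := 2) [0, 1] 2 (Equiv.refl _).toEmbedding rfl
    (fun i => by fin_cases i <;> rfl) rfl, place_toEmbedding]
  exact (Iso.refl_conj _).symm

lemma mk_cnot : mk Circ.cnot = cnotList [(0 : Fin 2)] 1 := by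
  rw [cnotList_eq_place (k := 1) [0] 1 (Equiv.refl _).toEmbedding rfl
    (fun i => by fin_cases i; rfl) rfl, place_toEmbedding]
  exact (Iso.refl_conj _).symm

lemma mk_not : mk Circ.not = cnotList [] (0 : Fin 1) := by
  rw [cnotList_eq_place (k := 0) [] 0 (Equiv.refl _).toEmbedding rfl
    (fun i => i.elim0) rfl, place_toEmbedding]
  exact (Iso.refl_conj _).symm

/-- The inclusion of a list of distinct wires; the identities between circuits on few wires are
carried to arbitrary wires along it. -/
def listEmb (l : List (Fin n)) (h : l.Nodup) : Fin l.length ↪ Fin n :=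
  ⟨l.get, List.nodup_iff_injective_get.1 h⟩

lemma commute_proj_cnotList (s : Ancilla) (hl : z ∉ l) (hx : z ≠ x) :
    Commute (s.proj z) (cnotList l x) := by
  rw [cnotList]
  split_ifs
  · refine Ancilla.commute_proj_place (fun i => ?_) _
    induction i using Fin.lastCases with
    | last => simpa using hx
    | cast i => simpa using ne_of_mem_of_not_mem (List.get_mem l i) hl |>.symm
  · exact Commute.one_right _

lemma commute_proj_proj (s t : Ancilla) (a b : Fin n) (h : a ≠ b) :
    Commute (s.proj a) (t.proj b) :=
  Ancilla.commute_proj_place (fun _ => h) _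

lemma place_last_cnotList (l : List (Fin n)) (x : Fin n) :
    place (Fin.last n).succAboveEmb (cnotList l x) =
      cnotList (l.map Fin.castSucc) x.castSucc := by
  rw [place_cnotList, Fin.coe_succAboveEmb, Fin.succAbove_last]

lemma restrictsTo_last_proj (s t : Ancilla) (a : Fin n) :
    s.RestrictsTo (Fin.last n) (t.proj a.castSucc) (t.proj a) := by
  have h := s.restrictsTo_place (Fin.last n) (t.proj a)
  rwa [Ancilla.place_proj, Fin.coe_succAboveEmb, Fin.succAbove_last] at h

lemma restrictsTo_last_cnotList (s : Ancilla) (l : List (Fin n)) (x : Fin n) :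
    s.RestrictsTo (Fin.last n) (cnotList (l.map Fin.castSucc) x.castSucc) (cnotList l x) :=
  place_last_cnotList l x ▸ s.restrictsTo_place _ _

lemma restrictsTo_last_iff {s : Ancilla} {F : Op (n + 1)} :
    s.RestrictsTo (Fin.last n) F (cnotList l x) ↔
      s.proj (Fin.last n) * F =
        s.proj (Fin.last n) * cnotList (l.map Fin.castSucc) x.castSucc := by
  rw [Ancilla.restrictsTo_iff, place_last_cnotList]

lemma tof_swap (a b x : Fin n) : cnotList [a, b] x = cnotList [b, a] x := by
  by_cases h : [a, b, x].Nodup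
  · have h3 : cnotList [(0 : Fin 3), 1] 2 = cnotList [1, 0] 2 := by
      have hσ := place_toEmbedding (Equiv.swap (0 : Fin 3) 1) (mk Circ.tof)
      rw [mk_tof, place_cnotList] at hσ
      refine Eq.trans ?_ hσ.symm
      rw [← mk_tof, Iso.conj_apply, ← Category.assoc]
      exact Quotient.sound Circ.Eqv.tof16
    have hx := congrArg (place (listEmb _ h)) h3
    rwa [place_cnotList, place_cnotList] at hx
  · rw [cnotList_eq_one, cnotList_eq_one] <;>
    · simp only [List.nodup_cons, List.mem_cons] at h ⊢
      grind

/-- The ancilla `|1⟩`. -/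
def Ancilla.one : Ancilla where
  ket := TOF.mk Circ.ket1
  bra := TOF.mk Circ.bra1
  ket_bra := Quotient.sound Circ.Eqv.tof9

open Ancilla

lemma one_proj_mul_tof (h : [a, b, x].Nodup) :
    one.proj a * cnotList [a, b] x = one.proj a * cnotList [b] x := by
  have h3 : one.proj (0 : Fin 3) * cnotList [0, 1] 2 = one.proj 0 * cnotList [1] 2 := by
    rw [← mk_tof, proj_zero_mul_of_ket_comp (s := one) (k := 2) (f := mk Circ.cnot)
      (Quotient.sound Circ.Eqv.tof1), mk_cnot, place_cnotList]
    rfl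
  have hx := congrArg (place (listEmb _ h)) h3
  simp only [map_mul, place_proj, place_cnotList] at hx
  exact hx

lemma one_proj_mul_cnot_mul_one_proj (h : a ≠ x) :
    one.proj a * cnotList [a] x * one.proj a = one.proj a * cnotList [] x := by
  have h2 : one.proj (0 : Fin 2) * cnotList [0] 1 * one.proj 0 = one.proj 0 * cnotList [] 1 := by
    rw [← mk_cnot, proj_zero_mul_mul_proj_zero (s := one) (k := 1) (f := mk Circ.not), mk_not,
      place_cnotList]
    · rfl
    · rw [id_zero_tensorMap, ← Category.assoc]
      rfl
  have hx := congrArg (place (listEmb [a, x] (by simpa using h))) h2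
  simp only [map_mul, place_proj, place_cnotList] at hx
  exact hx

lemma one_proj_mul_cnot (h : a ≠ x) :
    one.proj a * cnotList [a] x = one.proj a * cnotList [] x := by
  have hpad : one.RestrictsTo (Fin.last n) (cnotList [Fin.last n, a.castSucc] x.castSucc)
      (cnotList [a] x) :=
    restrictsTo_last_iff.2 (one_proj_mul_tof (by simp [h, Fin.castSucc_ne_last, ne_comm]))
  have hproj := restrictsTo_last_proj one one a
  have hfix : one.proj a.castSucc * cnotList [Fin.last n, a.castSucc] x.castSucc *
      one.proj a.castSucc =
        one.proj a.castSucc * cnotList [Fin.last n, a.castSucc] x.castSucc := by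
    rw [tof_swap, one_proj_mul_tof (by simp [h, Fin.castSucc_ne_last, ne_comm]), mul_assoc,
      ← (commute_proj_cnotList one (by simp [Fin.castSucc_ne_last]) (by simp [h])).eq, ← mul_assoc,
      (isIdempotentElem_proj one _).eq]
  have hF := (hproj.mul hpad).mul hproj
  rw [hfix] at hF
  rw [← one_proj_mul_cnot_mul_one_proj h]
  exact (hproj.mul hpad).unique hF

lemma restrictsTo_one_cnotList_of_length_le_one (hl : l.length ≤ 1) :
    one.RestrictsTo (Fin.last n) (cnotList (Fin.last n :: l.map Fin.castSucc) x.castSucc)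
      (cnotList l x) := by
  by_cases hx : x ∈ l
  · rw [cnotList_eq_one (by simp [hx]), cnotList_eq_one (by simp [hx])]
    exact restrictsTo_one
  refine restrictsTo_last_iff.2 ?_
  match l, hl with
  | [], _ => exact one_proj_mul_cnot (Fin.castSucc_ne_last x).symm
  | [a], _ =>
    have hax : a ≠ x := fun h => hx (by simp [h])
    exact one_proj_mul_tof (by simp [hax, Fin.castSucc_ne_last, ne_comm])

lemma tof_sq (a b x : Fin n) : cnotList [a, b] x * cnotList [a, b] x = 1 := by
  by_cases h : [a, b, x].Nodup
  · have h3 : cnotList [(0 : Fin 3), 1] 2 * cnotList [0, 1] 2 = 1 := by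
      rw [← mk_tof]
      exact Quotient.sound Circ.Eqv.tof10
    have hx := congrArg (place (listEmb _ h)) h3
    simp only [map_mul, place_cnotList, map_one] at hx
    exact hx
  · rw [cnotList_eq_one, one_mul]
    simp only [List.nodup_cons, List.mem_cons] at h ⊢
    grind

lemma cnotList_sq_of_length_le_one (hl : l.length ≤ 1)
    (h : cnotList (Fin.last n :: l.map Fin.castSucc) x.castSucc *
      cnotList (Fin.last n :: l.map Fin.castSucc) x.castSucc = 1) :
    cnotList l x * cnotList l x = 1 := by
  have hpad := restrictsTo_one_cnotList_of_length_le_one (x := x) hl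
  have hsq := hpad.mul hpad
  rw [h] at hsq
  exact hsq.unique restrictsTo_one

lemma cnot_sq (a x : Fin n) : cnotList [a] x * cnotList [a] x = 1 :=
  cnotList_sq_of_length_le_one le_rfl (tof_sq _ _ _)

lemma not_sq (x : Fin n) : cnotList [] x * cnotList [] x = 1 :=
  cnotList_sq_of_length_le_one (Nat.zero_le _) (cnot_sq _ _)

/-- The ancilla `|0⟩`. -/
def Ancilla.zero : Ancilla where
  ket := TOF.mk Circ.ket0
  bra := TOF.mk Circ.bra0
  ket_bra := by
    have h : TOF.mk Circ.not ≫ TOF.mk Circ.not = 𝟙 (of 1) := mk_not ▸ not_sq 0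
    have hket : TOF.mk Circ.ket0 = one.ket ≫ TOF.mk Circ.not := rfl
    have hbra : TOF.mk Circ.bra0 = TOF.mk Circ.not ≫ one.bra := rfl
    rw [hket, hbra, Category.assoc, ← Category.assoc (TOF.mk Circ.not), h, Category.id_comp,
      one.ket_bra]

lemma zero_proj_mul_tof (a b x : Fin n) : zero.proj a * cnotList [a, b] x = zero.proj a := by
  by_cases h : [a, b, x].Nodup
  · have h3 : zero.proj (0 : Fin 3) * cnotList [0, 1] 2 = zero.proj 0 := by
      rw [← mk_tof, proj_zero_mul_of_ket_comp (s := zero) (k := 2) (f := 1)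
        (Quotient.sound Circ.Eqv.tof2), map_one]
      exact mul_one _
    have hx := congrArg (place (listEmb _ h)) h3
    simp only [map_mul, place_proj, place_cnotList] at hx
    exact hx
  · rw [cnotList_eq_one, mul_one]
    simp only [List.nodup_cons, List.mem_cons] at h ⊢
    grind

lemma tof_mul_zero_proj (a b x : Fin n) : cnotList [a, b] x * zero.proj a = zero.proj a := by
  by_cases h : [a, b, x].Nodup
  · have h3 : cnotList [(0 : Fin 3), 1] 2 * zero.proj 0 = zero.proj 0 := by
      rw [← mk_tof, mul_proj_zero_of_comp_bra (s := zero) (k := 2) (f := 1)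
        (Quotient.sound Circ.Eqv.tof2'), map_one]
      exact one_mul _
    have hx := congrArg (place (listEmb _ h)) h3
    simp only [map_mul, place_proj, place_cnotList] at hx
    exact hx
  · rw [cnotList_eq_one, one_mul]
    simp only [List.nodup_cons, List.mem_cons] at h ⊢
    grind

lemma zero_proj_mul_cnot (a x : Fin n) : zero.proj a * cnotList [a] x = zero.proj a := by
  have hpad : one.RestrictsTo (Fin.last n) (cnotList [Fin.last n, a.castSucc] x.castSucc)
      (cnotList [a] x) :=
    restrictsTo_one_cnotList_of_length_le_one (l := [a]) le_rfl
  have hF := (restrictsTo_last_proj one zero a).mul hpad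
  rw [tof_swap, zero_proj_mul_tof] at hF
  exact hF.unique (restrictsTo_last_proj one zero a)

lemma cnot_mul_zero_proj (a x : Fin n) : cnotList [a] x * zero.proj a = zero.proj a := by
  have hpad : one.RestrictsTo (Fin.last n) (cnotList [Fin.last n, a.castSucc] x.castSucc)
      (cnotList [a] x) :=
    restrictsTo_one_cnotList_of_length_le_one (l := [a]) le_rfl
  have hF := hpad.mul (restrictsTo_last_proj one zero a)
  rw [tof_swap, tof_mul_zero_proj] at hF
  exact hF.unique (restrictsTo_last_proj one zero a)

lemma cnot_cnot_cnot_mul_proj (s : Ancilla) :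
    cnotList [(0 : Fin 2)] 1 * cnotList [1] 0 * cnotList [0] 1 * s.proj 0 =
      s.proj 1 * (cnotList [(0 : Fin 2)] 1 * cnotList [1] 0 * cnotList [0] 1) := by
  have hswap : cnotList [(0 : Fin 2)] 1 * cnotList [1] 0 * cnotList [0] 1 =
      (permIso (Equiv.swap (0 : Fin 2) 1)).hom := by
    rw [← mk_cnotOn (a := (0 : Fin 2)) (c := 1) (by decide),
      ← mk_cnotOn (a := (1 : Fin 2)) (c := 0) (by decide)]
    exact Quotient.sound Circ.Eqv.tof15
  have hσ := place_toEmbedding (Equiv.swap (0 : Fin 2) 1) (s.proj 1)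
  rw [place_proj, Iso.conj_apply] at hσ
  rw [hswap]
  exact (Iso.eq_inv_comp _).1 hσ

lemma zero_proj_mul_cnot_mul_zero_proj (h : w ≠ z) :
    zero.proj w * cnotList [z] w * zero.proj w = zero.proj w * zero.proj z := by
  have h2 : zero.proj (0 : Fin 2) * cnotList [1] 0 * zero.proj 0 = zero.proj 0 * zero.proj 1 := by
    have h01 := commute_proj_proj zero zero (0 : Fin 2) 1 (by decide)
    calc zero.proj 0 * cnotList [1] 0 * zero.proj 0
        = zero.proj 0 * cnotList [0] 1 * cnotList [1] 0 * (cnotList [0] 1 * zero.proj 0) := by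
          rw [zero_proj_mul_cnot, cnot_mul_zero_proj]
      _ = zero.proj 0 * (cnotList [0] 1 * cnotList [1] 0 * cnotList [0] 1 * zero.proj 0) := by
          simp only [mul_assoc]
      _ = zero.proj 1 * (zero.proj 0 * cnotList [0] 1) * cnotList [1] 0 * cnotList [0] 1 := by
          rw [cnot_cnot_cnot_mul_proj, ← mul_assoc, h01.eq]; simp only [mul_assoc]
      _ = zero.proj 0 * (zero.proj 1 * cnotList [1] 0) * cnotList [0] 1 := by
          rw [zero_proj_mul_cnot, ← h01.eq]; simp only [mul_assoc]
      _ = zero.proj 0 * zero.proj 1 := by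
          rw [zero_proj_mul_cnot, h01.eq, mul_assoc, zero_proj_mul_cnot]
  have hx := congrArg (place (listEmb [w, z] (by simpa using h))) h2
  simp only [map_mul, place_proj, place_cnotList] at hx
  exact hx

/-! ### Commuting gates -/

lemma commute_cnotList_map (e : Fin n ↪ Fin m) (h : Commute (cnotList l x) (cnotList l' y)) :
    Commute (cnotList (l.map e) (e x)) (cnotList (l'.map e) (e y)) := by
  rw [← place_cnotList, ← place_cnotList]
  exact h.map _

lemma commute_cnotList_of_disjoint (h : (x :: l).Disjoint (y :: l')) :
    Commute (cnotList l x) (cnotList l' y) := by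
  have mem_of_snoc (l : List (Fin n)) (x : Fin n) (i) :
      Fin.snoc (α := fun _ => Fin n) l.get x i ∈ x :: l := by
    induction i using Fin.lastCases with
    | last => simp
    | cast i => simp
  rw [cnotList, cnotList]
  split_ifs
  · exact place_commute _ _
      (fun i j hij => h (mem_of_snoc l x i)
        ((congrArg (· ∈ y :: l') hij).mpr (mem_of_snoc l' y j))) _ _
  · exact Commute.one_right _
  · exact Commute.one_left _
  · exact Commute.one_left _

lemma tof_commute_of_same_target (h : [a, b, x, c, d].Nodup) :
    Commute (cnotList [a, b] x) (cnotList [d, c] x) := by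
  have h5 : Commute (cnotList [(0 : Fin 5), 1] 2) (cnotList [4, 3] 2) := by
    rw [← mk_tofOn (by decide), ← mk_tofOn (by decide)]
    exact Quotient.sound Circ.Eqv.tof3
  exact commute_cnotList_map (listEmb _ h) h5

lemma tof_commute_of_common_control (hca : c ≠ a) (hcb : c ≠ b) (hab : a ≠ b)
    (hx : x ∉ [a, b, c]) (hy : y ∉ [a, b, c]) :
    Commute (cnotList [a, c] x) (cnotList [b, c] y) := by
  rcases eq_or_ne x y with rfl | hxy
  · have h4 : Commute (cnotList [(0 : Fin 4), 2] 3) (cnotList [1, 2] 3) := by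
      rw [← mk_tofOn (by decide), ← mk_tofOn (by decide)]
      exact Quotient.sound Circ.Eqv.tof6
    exact commute_cnotList_map (listEmb [a, b, c, x] (by grind)) h4
  · have h5 : Commute (cnotList [(2 : Fin 5), 1] 0) (cnotList [2, 3] 4) := by
      rw [← mk_tofOn (by decide), ← mk_tofOn (by decide)]
      exact Quotient.sound Circ.Eqv.tof4
    rw [tof_swap a, tof_swap b]
    exact commute_cnotList_map (listEmb [x, a, c, b, y] (by grind)) h5

lemma tof_commute_of_same_controls (hab : a ≠ b) (hx : x ∉ [a, b]) (hy : y ∉ [a, b]) :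
    Commute (cnotList [a, b] x) (cnotList [a, b] y) := by
  rcases eq_or_ne x y with rfl | hxy
  · exact Commute.refl _
  · have h4 : Commute (cnotList [(2 : Fin 4), 1] 0) (cnotList [1, 2] 3) := by
      rw [← mk_tofOn (by decide), ← mk_tofOn (by decide)]
      exact Quotient.sound Circ.Eqv.tof5
    rw [tof_swap a b x]
    exact commute_cnotList_map (listEmb [x, a, b, y] (by grind)) h4

lemma tof_commute (hx : x ∉ [c, d]) (hy : y ∉ [a, b]) :
    Commute (cnotList [a, b] x) (cnotList [c, d] y) := by
  by_cases h1 : [a, b].Nodup ∧ x ∉ [a, b]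
  swap
  · rw [cnotList_eq_one h1]
    exact Commute.one_left _
  by_cases h2 : [c, d].Nodup ∧ y ∉ [c, d]
  swap
  · rw [cnotList_eq_one h2]
    exact Commute.one_right _
  simp only [List.nodup_cons, List.mem_cons, List.not_mem_nil, or_false, List.nodup_nil,
    not_false_eq_true, and_true, not_or] at h1 h2 hx hy
  obtain ⟨hab, hxab⟩ := h1
  obtain ⟨hcd, hycd⟩ := h2
  rcases eq_or_ne a c with rfl | hac
  · rcases eq_or_ne b d with rfl | hbd
    · exact tof_commute_of_same_controls hab (by grind) (by grind)
    · rw [tof_swap a b, tof_swap a d]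
      exact tof_commute_of_common_control hab hcd hbd (by grind) (by grind)
  rcases eq_or_ne a d with rfl | had
  · rw [tof_swap c a]
    rcases eq_or_ne b c with rfl | hbc
    · exact tof_commute_of_same_controls hab (by grind) (by grind)
    · rw [tof_swap a b, tof_swap a c]
      exact tof_commute_of_common_control hab hac hbc (by grind) (by grind)
  rcases eq_or_ne b c with rfl | hbc
  · rw [tof_swap b d]
    exact tof_commute_of_common_control (Ne.symm hab) hcd had (by grind) (by grind)
  rcases eq_or_ne b d with rfl | hbd
  · exact tof_commute_of_common_control (Ne.symm hab) (Ne.symm hcd) hac (by grind)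
      (by grind)
  rcases eq_or_ne x y with rfl | hxy
  · exact tof_commute_of_same_target (by grind)
  · exact commute_cnotList_of_disjoint (by grind [List.Disjoint])

lemma tof_cnot_tof (h : [a, b, c, x].Nodup) :
    cnotList [a, b] c * cnotList [c] x * cnotList [a, b] c =
      cnotList [a, b] x * cnotList [c] x := by
  have h4 : cnotList [(0 : Fin 4), 1] 2 * cnotList [2] 3 * cnotList [0, 1] 2 =
      cnotList [0, 1] 3 * cnotList [2] 3 := by
    rw [← mk_tofOn (by decide), ← mk_tofOn (by decide), ← mk_cnotOn (by decide)]
    exact Quotient.sound Circ.Eqv.tof14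
  have hx := congrArg (place (listEmb _ h)) h4
  simp only [map_mul, place_cnotList] at hx
  exact hx

lemma tof_tof_tof (h : [a, b, c, x].Nodup) :
    cnotList [a, b] c * cnotList [b, c] x * cnotList [a, b] c =
      cnotList [a, b] x * cnotList [b, c] x := by
  have h4 : cnotList [(0 : Fin 4), 1] 2 * cnotList [1, 2] 3 * cnotList [0, 1] 2 =
      cnotList [0, 1] 3 * cnotList [1, 2] 3 := by
    rw [← mk_tofOn (by decide), ← mk_tofOn (by decide), ← mk_tofOn (by decide)]
    exact Quotient.sound Circ.Eqv.tof13
  have hx := congrArg (place (listEmb _ h)) h4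
  simp only [map_mul, place_cnotList] at hx
  exact hx

lemma cnot_tof_cnot (h : [a, b, c, x].Nodup) :
    cnotList [a] b * cnotList [b, c] x * cnotList [a] b =
      cnotList [a, c] x * cnotList [b, c] x := by
  have h4 : cnotList [(0 : Fin 4)] 1 * cnotList [1, 2] 3 * cnotList [0] 1 =
      cnotList [0, 2] 3 * cnotList [1, 2] 3 := by
    rw [← mk_tofOn (by decide), ← mk_tofOn (by decide), ← mk_cnotOn (by decide)]
    exact Quotient.sound Circ.Eqv.tof12
  have hx := congrArg (place (listEmb _ h)) h4
  simp only [map_mul, place_cnotList] at hx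
  exact hx

lemma mk_cnotN_add_three (k : ℕ) :
    mk (Circ.cnotN (k + 3)) = zero.compress (2 : Fin (k + 5))
      (place (Fin.castLEEmb (Nat.le_add_left 3 (k + 2))) (mk Circ.tof) *
        place (Fin.addNatEmb 2) (mk (Circ.cnotN (k + 2))) *
        place (Fin.castLEEmb (Nat.le_add_left 3 (k + 2))) (mk Circ.tof)) := by
  simp only [← mk_on, compress, Op.mul_def, ← Category.assoc]
  rfl

lemma cnotList_cons_cons_cons (h : (a :: b :: c :: l).Nodup) (hx : x ∉ a :: b :: c :: l) :
    cnotList (a :: b :: c :: l) x = zero.compress (Fin.last n)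
      (cnotList ([a, b].map Fin.castSucc) (Fin.last n) *
        cnotList (Fin.last n :: (c :: l).map Fin.castSucc) x.castSucc *
        cnotList ([a, b].map Fin.castSucc) (Fin.last n)) := by
  let w : Fin (l.length + 4) ↪ Fin n := ⟨_, injective_snoc_get_iff.2 ⟨h, hx⟩⟩
  have hcontrol (i : Fin (l.length + 3)) : w i.castSucc = (a :: b :: c :: l).get i :=
    Fin.snoc_castSucc (α := fun _ => Fin n) _ _ _
  have htarget : w (Fin.last (l.length + 3)) = x := Fin.snoc_last (α := fun _ => Fin n) _ _
  let W : Fin (l.length + 5) ↪ Fin (n + 1) := insertWire 2 (Fin.last n) w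
  have hW (i : Fin (l.length + 4)) : W ((2 : Fin (l.length + 5)).succAbove i) = (w i).castSucc := by
    rw [insertWire_succAbove, Fin.succAbove_last]
  have hW2 : W 2 = Fin.last n := insertWire_self _ _ _
  have haddNat (i : Fin (l.length + 2)) :
      (2 : Fin (l.length + 5)).succAbove (i.addNat 2) = i.succ.addNat 2 :=
    Fin.succAbove_of_le_castSucc _ _ ((Nat.mod_le _ _).trans (Nat.le_add_left 2 i))
  have htof := cnotList_eq_place (k := 2) [a.castSucc, b.castSucc] (Fin.last n)
    ((Fin.castLEEmb (Nat.le_add_left 3 (l.length + 2))).trans W) rfl (fun i => by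
      fin_cases i
      · exact (hW 0).trans (congrArg _ (hcontrol 0))
      · exact (hW 1).trans (congrArg _ (hcontrol 1))) hW2
  have htarget' : W ((Fin.last (l.length + 2)).addNat 2) = x.castSucc :=
    (congrArg W (haddNat (Fin.last _)).symm).trans ((hW _).trans (congrArg _ htarget))
  have hcnotN := cnotList_eq_place (k := l.length + 2) (Fin.last n :: (c :: l).map Fin.castSucc)
    x.castSucc ((Fin.addNatEmb 2).trans W) (by simp) (fun i => by
      induction i using Fin.cases with
      | zero => exact hW2
      | succ i =>
        refine (congrArg W (haddNat i.castSucc).symm).trans ((hW _).trans ?_)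
        refine (congrArg _ (hcontrol (i.addNat 2))).trans ?_
        simp [-List.map_cons]) htarget'
  rw [cnotList_eq_place _ x w rfl hcontrol htarget, mk_cnotN_add_three,
    place_compress w 2 (Fin.last n), map_mul, map_mul, place_place, place_place, List.map_cons,
    List.map_cons, List.map_nil, htof, hcnotN]
  rfl

/-- Gates with `k` and with `k'` controls commute, if neither target is a control of the other gate;
the statement that the induction on the numbers of controls is about. -/
def CommuteAt (k k' : ℕ) : Prop :=
  ∀ (n : ℕ) (l l' : List (Fin n)) (x y : Fin n), l.length = k → l'.length = k' → x ∉ l' → y ∉ l →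
    Commute (cnotList l x) (cnotList l' y)

namespace CommuteAt

variable {k k' : ℕ}

lemma symm (h : CommuteAt k k') : CommuteAt k' k :=
  fun n l l' x y hl hl' hx hy => (h n l' l y x hl' hl hy hx).symm

lemma of_succ (hk : k ≤ 1) (h : CommuteAt (k + 1) k') : CommuteAt k k' :=
  fun n l l' x y hl hl' hx hy =>
    (restrictsTo_one_cnotList_of_length_le_one (hl.trans_le hk)).commute
      (restrictsTo_last_cnotList one l' y)
      (h _ _ _ _ _ (by simp [hl]) (by simpa using hl') (by simpa using hx) (by simpa using hy))

lemma succ (hk : 2 ≤ k) (h2 : CommuteAt 2 k') (h : CommuteAt k k') : CommuteAt (k + 1) k' := by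
  intro n l l' x y hl hl' hx hy
  by_cases hn : l.Nodup ∧ x ∉ l
  swap
  · rw [cnotList_eq_one hn]
    exact Commute.one_left _
  obtain ⟨a, b, c, l, rfl⟩ : ∃ a b c t, l = a :: b :: c :: t := by
    match l, hl with
    | a :: b :: c :: l, _ => exact ⟨a, b, c, l, rfl⟩
    | [_, _], hl | [_], hl | [], hl => grind
  rw [cnotList_cons_cons_cons hn.1 hn.2]
  apply commute_compress
  rw [place_last_cnotList]
  have htof : Commute (cnotList ([a, b].map Fin.castSucc) (Fin.last n))
      (cnotList (l'.map Fin.castSucc) y.castSucc) :=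
    h2 _ _ _ _ _ rfl (by simpa using hl') (by simp [Fin.castSucc_ne_last]) (by grind)
  have hcnot : Commute (cnotList (Fin.last n :: (c :: l).map Fin.castSucc) x.castSucc)
      (cnotList (l'.map Fin.castSucc) y.castSucc) :=
    h _ _ _ _ _ (by simpa using hl) (by simpa using hl') (by simpa using hx)
      (by grind)
  exact (htof.mul_left hcnot).mul_left htof

lemma of_two (h : CommuteAt 2 k') (k : ℕ) : CommuteAt k k' := by
  have h1 := of_succ le_rfl h
  rcases Nat.lt_or_ge k 2 with hk | hk
  · interval_cases k
    exacts [of_succ (Nat.zero_le _) h1, h1]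
  · induction k, hk using Nat.le_induction with
    | base => exact h
    | succ k hk ih => exact succ hk h ih

end CommuteAt

lemma commuteAt (k k' : ℕ) : CommuteAt k k' := by
  have h2 : CommuteAt 2 2 := by
    intro n l l' x y hl hl' hx hy
    obtain ⟨a, b, rfl⟩ := List.length_eq_two.1 hl
    obtain ⟨c, d, rfl⟩ := List.length_eq_two.1 hl'
    exact tof_commute hx hy
  exact ((h2.of_two k').symm).of_two k

lemma cnotList_commute (hx : x ∉ l') (hy : y ∉ l) : Commute (cnotList l x) (cnotList l' y) :=
  commuteAt _ _ n l l' x y rfl rfl hx hy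

/-! ### Merging two controls -/

lemma last_ne_castSucc (z : Fin n) : Fin.last n ≠ z.castSucc := (Fin.castSucc_ne_last z).symm

lemma last_notMem_map_castSucc (l : List (Fin n)) : Fin.last n ∉ l.map Fin.castSucc := by
  simp

lemma zero_compress_cnot (z : Fin n) :
    zero.compress (Fin.last n) (cnotList [z.castSucc] (Fin.last n)) = zero.proj z := by
  apply eq_of_proj_mul_place_eq (s := zero) (z := Fin.last n)
  rw [proj_mul_place_compress, zero_proj_mul_cnot_mul_zero_proj (last_ne_castSucc z),
    place_proj, Fin.coe_succAboveEmb, Fin.succAbove_last]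

lemma commute_zero_proj {F : Op n} (h : Commute (cnotList [z.castSucc] (Fin.last n))
    (place (Fin.last n).succAboveEmb F)) : Commute (zero.proj z) F :=
  zero_compress_cnot z ▸ commute_compress h

lemma commute_zero_proj_tof_conj (h : [a, b, z, x].Nodup) :
    Commute (zero.proj z) (cnotList [a, b] z * cnotList (z :: l) x * cnotList [a, b] z) := by
  apply commute_zero_proj
  simp only [map_mul, place_last_cnotList]
  set w := Fin.last n with hw
  have hT : cnotList ([a, b].map Fin.castSucc) z.castSucc * cnotList [z.castSucc] w *
      cnotList ([a, b].map Fin.castSucc) z.castSucc =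
      cnotList ([a, b].map Fin.castSucc) w * cnotList [z.castSucc] w :=
    tof_cnot_tof (by grind)
  have hGC : Commute (cnotList ((z :: l).map Fin.castSucc) x.castSucc)
      (cnotList [z.castSucc] w) :=
    cnotList_commute (by grind) (by simp [hw, last_ne_castSucc])
  have hGD : Commute (cnotList ((z :: l).map Fin.castSucc) x.castSucc)
      (cnotList ([a, b].map Fin.castSucc) w) :=
    cnotList_commute (by grind) (by simp [hw, last_ne_castSucc])
  have hT2 := tof_sq a.castSucc b.castSucc z.castSucc
  simp only [List.map_cons, List.map_nil] at hT hGC hGD ⊢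
  exact commute_conj_of_conj_eq_mul hT2 hT hGC hGD

lemma zero_restrictsTo_tof_conj (h : (a :: b :: l).Nodup) (hx : x ∉ a :: b :: l) :
    zero.RestrictsTo (Fin.last n)
      (cnotList [a.castSucc, b.castSucc] (Fin.last n) *
        cnotList (Fin.last n :: l.map Fin.castSucc) x.castSucc *
        cnotList [a.castSucc, b.castSucc] (Fin.last n))
      (cnotList (a :: b :: l) x) := by
  have hwires : [a.castSucc, b.castSucc, Fin.last n, x.castSucc].Nodup := by
    grind
  match l with
  | [] =>
    have hproj : Commute (zero.proj (Fin.last n)) (cnotList [a.castSucc, b.castSucc] x.castSucc) :=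
      commute_proj_cnotList zero (last_notMem_map_castSucc [a, b]) (last_ne_castSucc x)
    rw [restrictsTo_last_iff, List.map_nil, tof_cnot_tof hwires, ← mul_assoc, hproj.eq, mul_assoc,
      zero_proj_mul_cnot]
    exact hproj.eq.symm
  | c :: l =>
    rw [cnotList_cons_cons_cons h hx]
    apply restrictsTo_compress
    rw [(commute_zero_proj_tof_conj hwires).eq, mul_assoc, (isIdempotentElem_proj _ _).eq]

/-! ### Permuting the controls -/

lemma place_last_injective : Function.Injective (place (n := n + 1) (Fin.last n).succAboveEmb) :=
  fun f g h => (zero.restrictsTo_place _ f).unique (h ▸ zero.restrictsTo_place _ g)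

lemma zero_proj_mul_cnotList (h : (z :: a :: b :: l).Nodup) (hx : x ∉ z :: a :: b :: l) :
    zero.proj z * cnotList (a :: b :: l) x =
      zero.proj z * (cnotList [a, b] z * cnotList (z :: l) x * cnotList [a, b] z) := by
  apply place_last_injective
  let σ : Fin (n + 1) ↪ Fin (n + 1) := (Equiv.swap (Fin.last n) z.castSucc).toEmbedding
  have hlast : σ (Fin.last n) = z.castSucc := Equiv.swap_apply_left _ _
  have hσ {y : Fin n} (hy : y ≠ z) : σ y.castSucc = y.castSucc :=
    Equiv.swap_apply_of_ne_of_ne (Fin.castSucc_ne_last y) (mt Fin.castSucc_inj.1 hy)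
  have hσl : ∀ y ∈ l, σ y.castSucc = y.castSucc := fun y hy => hσ (by grind)
  have hconj := congrArg (place σ) (restrictsTo_last_iff.1
    (zero_restrictsTo_tof_conj (List.nodup_cons.1 h).2 (mt (List.mem_cons_of_mem z) hx)))
  simp only [List.nodup_cons, List.mem_cons, not_or] at h hx
  simp only [map_mul, place_proj, place_cnotList, List.map_cons, List.map_nil, List.map_map,
    Function.comp_def, hlast, hσ (Ne.symm h.1.1), hσ (Ne.symm h.1.2.1), hσ hx.1,
    List.map_congr_left hσl] at hconj
  simp only [map_mul, place_proj, place_cnotList, List.map_cons, List.map_nil,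
    Fin.coe_succAboveEmb, Fin.succAbove_last, hconj]

lemma zero_proj_mul_zero_proj_mul_cnotList (h : (w :: z :: a :: b :: c :: l).Nodup)
    (hx : x ∉ w :: z :: a :: b :: c :: l) :
    zero.proj w * (zero.proj z * cnotList (a :: b :: c :: l) x) =
      zero.proj w * (zero.proj z *
        (cnotList [a, b, c] w * cnotList (w :: l) x * cnotList [a, b, c] w)) := by
  have hsplit : zero.proj z * cnotList (a :: b :: c :: l) x =
      zero.proj z * (cnotList [a, b] z * cnotList (z :: c :: l) x * cnotList [a, b] z) :=
    zero_proj_mul_cnotList (by grind) (by grind)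
  have hsplit' : zero.proj w * cnotList (z :: c :: l) x =
      zero.proj w * (cnotList [z, c] w * cnotList (w :: l) x * cnotList [z, c] w) :=
    zero_proj_mul_cnotList (by grind) (by grind)
  have hthree : zero.proj z * cnotList [a, b, c] w =
      zero.proj z * (cnotList [a, b] z * cnotList [z, c] w * cnotList [a, b] z) :=
    zero_proj_mul_cnotList (by grind) (by grind)
  have htof : Commute (cnotList [a, b] z) (cnotList (w :: l) x) :=
    cnotList_commute (by grind) (by grind)
  have hz : Commute (zero.proj z) (cnotList [a, b, c] w * cnotList (w :: l) x) :=
    (commute_proj_cnotList zero (by grind) (by grind)).mul_right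
      (commute_proj_cnotList zero (by grind) (by grind))
  have hw : Commute (zero.proj w) (cnotList [a, b] z) :=
    commute_proj_cnotList zero (by grind) (by grind)
  have hwz : Commute (zero.proj w) (zero.proj z) := commute_proj_proj _ _ _ _ (by grind)
  have hconj : zero.proj z * (cnotList [a, b, c] w * cnotList (w :: l) x * cnotList [a, b, c] w) =
      zero.proj z * (cnotList [a, b] z *
        (cnotList [z, c] w * cnotList (w :: l) x * cnotList [z, c] w) * cnotList [a, b] z) :=
    mul_conj_eq_of_mul_eq_mul_conj (tof_sq _ _ _) hz hthree htof
  rw [hsplit, hconj, hwz.left_comm, mul_conj_congr hw hsplit', hwz.left_comm]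

lemma place_swap_mk_cnotN_three :
    place (Equiv.swap (1 : Fin 4) 2).toEmbedding (mk (Circ.cnotN 3)) = mk (Circ.cnotN 3) := by
  have hleft : (Fin.castLEEmb (Nat.le_add_left 3 2) : Fin 3 ↪ Fin 5) =
      ⟨![(0 : Fin 5), 1, 2], by decide⟩ := by
    ext i; fin_cases i <;> rfl
  have hright : (Fin.addNatEmb 2 : Fin 3 ↪ Fin 5) = ⟨![(2 : Fin 5), 3, 4], by decide⟩ := by
    ext i; fin_cases i <;> rfl
  have hcnotN : mk (Circ.cnotN 3) = mk (Circ.comp (Circ.comp (Circ.comp (Circ.comp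
      (Circ.insertAt Circ.ket0 2) (Circ.tofOn (0 : Fin 5) 1 2)) (Circ.tofOn 2 3 4))
        (Circ.tofOn 0 1 2)) (Circ.removeAt Circ.bra0 2)) := by
    rw [Circ.tofOn, Circ.tofOn, ← hleft, ← hright]
    rfl
  have hswap : mk (Circ.cnotN 3) = (mk (Circ.perm (Equiv.swap (1 : Fin 4) 2)) ≫
      mk (Circ.cnotN 3)) ≫ mk (Circ.perm (Equiv.swap (1 : Fin 4) 2)) := by
    rw [hcnotN]
    exact Quotient.sound Circ.Eqv.tof17
  rw [place_toEmbedding, Iso.conj_apply, ← Category.assoc]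
  exact hswap.symm

lemma cnotList_swap_three (a b c x : Fin n) : cnotList [a, b, c] x = cnotList [a, c, b] x := by
  by_cases h : [a, b, c, x].Nodup
  · have hplace : cnotList [a, b, c] x = place (listEmb [a, b, c, x] h) (mk (Circ.cnotN 3)) :=
      cnotList_eq_place (k := 3) _ _ _ rfl (fun i => by fin_cases i <;> rfl) rfl
    have hplace' : cnotList [a, c, b] x = place ((Equiv.swap (1 : Fin 4) 2).toEmbedding.trans
        (listEmb [a, b, c, x] h)) (mk (Circ.cnotN 3)) :=
      cnotList_eq_place (k := 3) _ _ _ rfl (fun i => by fin_cases i <;> rfl) rfl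
    rw [hplace, hplace', ← place_place, place_swap_mk_cnotN_three]
  · rw [cnotList_eq_one (by grind), cnotList_eq_one (by grind)]

lemma cnotList_cons_swap (h : (c :: a :: b :: l).Nodup) (hx : x ∉ c :: a :: b :: l) :
    cnotList (c :: a :: b :: l) x = cnotList (c :: b :: a :: l) x := by
  apply eq_of_proj_mul_place_eq (s := zero) (z := Fin.last n)
  apply eq_of_proj_mul_place_eq (s := zero) (z := Fin.last (n + 1))
  have hfresh {p : List (Fin n)} (hp : p.Nodup) (hx : x ∉ p) :
      (Fin.last (n + 1) :: (Fin.last n).castSucc :: (p.map Fin.castSucc).map Fin.castSucc).Nodup ∧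
        x.castSucc.castSucc ∉
          Fin.last (n + 1) :: (Fin.last n).castSucc :: (p.map Fin.castSucc).map Fin.castSucc := by
    simp [last_ne_castSucc, Fin.castSucc_ne_last, hx,
      hp.map ((Fin.castSucc_injective _).comp (Fin.castSucc_injective _))]
  have habc := hfresh h hx
  have hacb := hfresh (p := c :: b :: a :: l) (by grind) (by grind)
  simp only [map_mul, place_proj, place_last_cnotList, Fin.coe_succAboveEmb, Fin.succAbove_last,
    List.map_cons] at habc hacb ⊢
  rw [zero_proj_mul_zero_proj_mul_cnotList habc.1 habc.2, cnotList_swap_three,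
    ← zero_proj_mul_zero_proj_mul_cnotList hacb.1 hacb.2]

lemma cnotList_append_swap (p : List (Fin n)) (a b : Fin n) (l : List (Fin n)) (x : Fin n) :
    cnotList (p ++ a :: b :: l) x = cnotList (p ++ b :: a :: l) x := by
  induction hk : p.length using Nat.strong_induction_on generalizing n with
  | _ k ih =>
  by_cases h : (p ++ a :: b :: l).Nodup ∧ x ∉ p ++ a :: b :: l
  swap
  · rw [cnotList_eq_one h, cnotList_eq_one (by grind)]
  have h' : (p ++ b :: a :: l).Nodup ∧ x ∉ p ++ b :: a :: l := by grind
  match p, hk with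
  | [], _ =>
    have hab := zero_restrictsTo_tof_conj h.1 h.2
    rw [tof_swap] at hab
    exact hab.unique (zero_restrictsTo_tof_conj h'.1 h'.2)
  | [c], _ => exact cnotList_cons_swap h.1 h.2
  | c :: d :: p, hk =>
    have hcd := zero_restrictsTo_tof_conj h.1 h.2
    have hprefix := ih (p.length + 1) (by grind) (Fin.last n :: p.map Fin.castSucc)
      a.castSucc b.castSucc (l.map Fin.castSucc) x.castSucc (by simp)
    simp only [List.append_eq, List.map_append, List.map_cons, List.cons_append] at hcd hprefix
    rw [hprefix] at hcd
    have hcd' := zero_restrictsTo_tof_conj h'.1 h'.2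
    simp only [List.append_eq, List.map_append, List.map_cons] at hcd'
    exact hcd.unique hcd'

lemma cnotList_perm (h : l.Perm l') (x : Fin n) : cnotList l x = cnotList l' x := by
  suffices ∀ p, cnotList (p ++ l) x = cnotList (p ++ l') x from this []
  induction h with
  | nil => exact fun p => rfl
  | cons a _ ih => exact fun p => by simpa using ih (p ++ [a])
  | swap a b l => exact fun p => cnotList_append_swap p b a l x
  | trans _ _ ih ih' => exact fun p => (ih p).trans (ih' p)

/-! ### Gates with a set of controls -/

variable {X Y : Finset (Fin n)}

/-- The not gate with target `x`, controlled by the wires in `X`; it is taken to be the identity if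
`x ∈ X`. -/
noncomputable def cnotSet (X : Finset (Fin n)) (x : Fin n) : Op n := cnotList X.toList x

lemma cnotSet_toFinset {l : List (Fin n)} (hl : l.Nodup) (x : Fin n) :
    cnotSet l.toFinset x = cnotList l x :=
  cnotList_perm (List.toFinset_toList hl) x

lemma mcx_eq_cnotSet (X : Finset (Fin n)) (x : Fin n) (hx : x ∉ X) : mcx X x hx = cnotSet X x := by
  have hsort : cnotList (X.sort (· ≤ ·)) x = mcx X x hx := by
    refine (cnotList_eq_place _ _ (Circ.ctrlWires X x hx) (by simp) (fun i => ?_) ?_).trans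
      (mk_on _ _).symm
    · change Fin.snoc (α := fun _ => Fin n) (X.orderEmbOfFin rfl) x i.castSucc = _
      rw [Fin.snoc_castSucc, Finset.orderEmbOfFin_apply]
      rfl
    · exact Fin.snoc_last (α := fun _ => Fin n) x (X.orderEmbOfFin rfl)
  rw [← hsort]
  exact cnotList_perm (Finset.sort_perm_toList X (· ≤ ·)) x

lemma cnotSet_of_mem (h : x ∈ X) : cnotSet X x = 1 := cnotList_eq_one (by simp [h])

lemma cnotSet_insert (ha : a ∉ X) (x : Fin n) :
    cnotSet (insert a X) x = cnotList (a :: X.toList) x :=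
  cnotList_perm (Finset.toList_insert ha) x

lemma cnotSet_empty (x : Fin n) : cnotSet ∅ x = cnotList [] x := by
  rw [cnotSet, Finset.toList_empty]

lemma cnotSet_singleton (a x : Fin n) : cnotSet {a} x = cnotList [a] x := by
  rw [cnotSet, Finset.toList_singleton]

lemma cnotSet_pair (h : a ≠ b) (x : Fin n) : cnotSet {a, b} x = cnotList [a, b] x := by
  rw [cnotSet_insert (by simpa using h), Finset.toList_singleton]

lemma cnotSet_commute (hx : x ∉ Y) (hy : y ∉ X) : Commute (cnotSet X x) (cnotSet Y y) :=
  cnotList_commute (by simpa using hx) (by simpa using hy)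

lemma commute_proj_cnotSet (s : Ancilla) (hz : z ∉ X) (hzx : z ≠ x) :
    Commute (s.proj z) (cnotSet X x) :=
  commute_proj_cnotList s (by simpa using hz) hzx

lemma place_last_cnotSet (X : Finset (Fin n)) (x : Fin n) :
    place (Fin.last n).succAboveEmb (cnotSet X x) =
      cnotSet (X.map Fin.castSuccEmb) x.castSucc := by
  rw [cnotSet, place_last_cnotList,
    ← cnotSet_toFinset (X.nodup_toList.map (Fin.castSucc_injective n))]
  congr 1
  ext i
  simp

lemma restrictsTo_last_cnotSet (s : Ancilla) (X : Finset (Fin n)) (x : Fin n) :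
    s.RestrictsTo (Fin.last n) (cnotSet (X.map Fin.castSuccEmb) x.castSucc) (cnotSet X x) :=
  place_last_cnotSet X x ▸ s.restrictsTo_place _ _

lemma last_notMem_map_castSuccEmb (X : Finset (Fin n)) : Fin.last n ∉ X.map Fin.castSuccEmb := by
  simp

lemma zero_restrictsTo_cnotSet_conj (hab : a ≠ b) (ha : a ∉ X) (hb : b ∉ X)
    (hx : x ∉ insert a (insert b X)) :
    zero.RestrictsTo (Fin.last n)
      (cnotSet {a.castSucc, b.castSucc} (Fin.last n) *
        cnotSet (insert (Fin.last n) (X.map Fin.castSuccEmb)) x.castSucc *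
        cnotSet {a.castSucc, b.castSucc} (Fin.last n))
      (cnotSet (insert a (insert b X)) x) := by
  have hlist : cnotSet (insert a (insert b X)) x = cnotList (a :: b :: X.toList) x := by
    rw [cnotSet_insert (by simp [hab, ha])]
    exact cnotList_perm ((Finset.toList_insert hb).cons a) x
  have hlast : cnotSet (insert (Fin.last n) (X.map Fin.castSuccEmb)) x.castSucc =
      cnotList (Fin.last n :: X.toList.map Fin.castSucc) x.castSucc := by
    rw [← cnotSet_toFinset
      (by simp [X.nodup_toList.map (Fin.castSucc_injective n)])]
    congr 1
    ext i
    simp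
  rw [hlist, hlast, cnotSet_pair (by simpa using hab)]
  exact zero_restrictsTo_tof_conj (by simp [hab, ha, hb, X.nodup_toList]) (by simpa using hx)

lemma control_induction {P : ∀ n, Finset (Fin n) → Prop} (empty : ∀ n, P n ∅)
    (singleton : ∀ n a, P n {a})
    (pair : ∀ n a b X, a ≠ b → a ∉ X → b ∉ X →
      P (n + 1) (insert (Fin.last n) (X.map Fin.castSuccEmb)) → P n (insert a (insert b X)))
    (n : ℕ) (X : Finset (Fin n)) : P n X := by
  induction hk : X.card using Nat.twoStepInduction generalizing n with
  | zero => exact Finset.card_eq_zero.1 hk ▸ empty n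
  | one =>
    obtain ⟨a, rfl⟩ := Finset.card_eq_one.1 hk
    exact singleton n a
  | more k _ ih =>
    obtain ⟨a, X', ha, rfl, hX'⟩ := Finset.card_eq_succ.1 hk
    obtain ⟨b, X, hb, rfl, hX⟩ := Finset.card_eq_succ.1 hX'
    simp only [Finset.mem_insert, not_or] at ha
    refine pair n a b X ha.1 ha.2 hb (ih _ _ ?_)
    rw [Finset.card_insert_of_notMem (last_notMem_map_castSuccEmb X), Finset.card_map, hX]

lemma cnotSet_sq (X : Finset (Fin n)) (x : Fin n) : cnotSet X x * cnotSet X x = 1 := by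
  induction n, X using control_induction with
  | empty n => rw [cnotSet_empty, not_sq]
  | singleton n a => rw [cnotSet_singleton, cnot_sq]
  | pair n a b X hab ha hb ih =>
    by_cases hx : x ∈ insert a (insert b X)
    · rw [cnotSet_of_mem hx, one_mul]
    have hconj := zero_restrictsTo_cnotSet_conj hab ha hb hx
    have htof : cnotSet {a.castSucc, b.castSucc} (Fin.last n) *
        cnotSet {a.castSucc, b.castSucc} (Fin.last n) = 1 := by
      rw [cnotSet_pair (by simpa using hab), tof_sq]
    refine (hconj.mul hconj).unique ?_
    rw [conj_mul_conj htof, ih x.castSucc, mul_one, htof]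
    exact restrictsTo_one

lemma proj_mul_cnotSet_insert_pair (s : Ancilla) {f : Op n} {F : Op (n + 1)} (hab : a ≠ b)
    (ha : a ∉ X) (hb : b ∉ X) (hw : w ∉ insert a (insert b X))
    (hx : x ∉ insert w (insert a (insert b X)))
    (hF : s.proj w.castSucc *
        cnotSet (insert w.castSucc (insert (Fin.last n) (X.map Fin.castSuccEmb))) x.castSucc =
      s.proj w.castSucc * F)
    (hf : zero.RestrictsTo (Fin.last n) (cnotSet {a.castSucc, b.castSucc} (Fin.last n) * F *
      cnotSet {a.castSucc, b.castSucc} (Fin.last n)) f) :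
    s.proj w * cnotSet (insert w (insert a (insert b X))) x = s.proj w * f := by
  simp only [Finset.mem_insert, not_or] at hw hx
  have hinsert : insert w (insert a (insert b X)) = insert a (insert b (insert w X)) := by
    rw [Finset.insert_comm w, Finset.insert_comm w]
  have hconj := zero_restrictsTo_cnotSet_conj (X := insert w X) (x := x) hab
    (by simp [Ne.symm hw.1, ha]) (by simp [Ne.symm hw.2.1, hb]) (by simp [hx])
  rw [Finset.map_insert, Fin.coe_castSuccEmb, Finset.insert_comm (Fin.last n)] at hconj
  have hproj : Commute (s.proj w.castSucc) (cnotSet {a.castSucc, b.castSucc} (Fin.last n)) :=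
    commute_proj_cnotSet s (by simp [hw]) (Fin.castSucc_ne_last w)
  have hmul := (restrictsTo_last_proj zero s w).mul hconj
  rw [mul_conj_congr hproj hF] at hmul
  rw [hinsert]
  exact hmul.unique ((restrictsTo_last_proj zero s w).mul hf)

lemma one_proj_mul_cnotSet_insert (hw : w ∉ X) (hwx : w ≠ x) :
    one.proj w * cnotSet (insert w X) x = one.proj w * cnotSet X x := by
  induction n, X using control_induction with
  | empty n =>
    rw [insert_empty_eq, cnotSet_singleton, cnotSet_empty, one_proj_mul_cnot hwx]
  | singleton n a =>
    by_cases hx : x = a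
    · rw [cnotSet_of_mem (by simp [hx]), cnotSet_of_mem (by simp [hx])]
    rw [Finset.mem_singleton] at hw
    rw [cnotSet_pair hw, cnotSet_singleton, one_proj_mul_tof (by grind)]
  | pair n a b X hab ha hb ih =>
    by_cases hx : x ∈ insert a (insert b X)
    · rw [cnotSet_of_mem hx, cnotSet_of_mem (Finset.mem_insert_of_mem hx)]
    refine proj_mul_cnotSet_insert_pair one hab ha hb hw (by simp [hwx.symm, hx]) (ih ?_ ?_)
      (zero_restrictsTo_cnotSet_conj hab ha hb hx)
    · simp_all
    · simpa using hwx

lemma zero_proj_mul_cnotSet_insert (X : Finset (Fin n)) (hw : w ∉ X) (x : Fin n) :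
    zero.proj w * cnotSet (insert w X) x = zero.proj w := by
  induction n, X using control_induction with
  | empty n => rw [insert_empty_eq, cnotSet_singleton, zero_proj_mul_cnot]
  | singleton n a => rw [cnotSet_pair (by simpa using hw), zero_proj_mul_tof]
  | pair n a b X hab ha hb ih =>
    by_cases hx : x ∈ insert w (insert a (insert b X))
    · rw [cnotSet_of_mem hx, mul_one]
    refine (proj_mul_cnotSet_insert_pair zero (F := 1) hab ha hb hw hx ?_ ?_).trans (mul_one _)
    · rw [ih (by simp_all), mul_one]
    · rw [mul_one, cnotSet_sq]
      exact restrictsTo_one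

lemma zero_proj_mul_cnotSet_of_mem (hw : w ∈ X) (x : Fin n) :
    zero.proj w * cnotSet X x = zero.proj w := by
  rw [← Finset.insert_erase hw, zero_proj_mul_cnotSet_insert _ (Finset.notMem_erase w X)]

lemma one_restrictsTo_cnotSet (X : Finset (Fin n)) (x : Fin n) :
    one.RestrictsTo (Fin.last n)
      (cnotSet (insert (Fin.last n) (X.map Fin.castSuccEmb)) x.castSucc) (cnotSet X x) := by
  rw [restrictsTo_iff, place_last_cnotSet]
  exact one_proj_mul_cnotSet_insert (last_notMem_map_castSuccEmb X) (last_ne_castSucc x)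

/-- The rule for conjugating the gate on `y` controlled by `x` and `Y` by the gate on `x` controlled
by `X`: the conjugation contributes a gate on `y` controlled by `X` and `Y`. -/
def ConjRule (X Y : Finset (Fin n)) (x y : Fin n) : Prop :=
  cnotSet X x * cnotSet (insert x Y) y * cnotSet X x = cnotSet (X ∪ Y) y * cnotSet (insert x Y) y

namespace ConjRule

lemma of_restrictsTo {s : Ancilla} {z : Fin (n + 1)} {C H K : Op (n + 1)}
    (hC : s.RestrictsTo z C (cnotSet X x)) (hH : s.RestrictsTo z H (cnotSet (insert x Y) y))
    (hK : s.RestrictsTo z K (cnotSet (X ∪ Y) y)) (h : C * H * C = K * H) : ConjRule X Y x y := by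
  have hconj := (hC.mul hH).mul hC
  rw [h] at hconj
  exact hconj.unique (hK.mul hH)

lemma of_insert_last_left
    (h : ConjRule (insert (Fin.last n) (X.map Fin.castSuccEmb)) (Y.map Fin.castSuccEmb)
      x.castSucc y.castSucc) : ConjRule X Y x y := by
  refine of_restrictsTo (one_restrictsTo_cnotSet X x) ?_ (one_restrictsTo_cnotSet (X ∪ Y) y)
    (h.trans ?_)
  · exact Finset.map_insert Fin.castSuccEmb x Y ▸ restrictsTo_last_cnotSet one (insert x Y) y
  · rw [Finset.insert_union, Finset.map_union]

lemma of_insert_last_right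
    (h : ConjRule (X.map Fin.castSuccEmb) (insert (Fin.last n) (Y.map Fin.castSuccEmb))
      x.castSucc y.castSucc) : ConjRule X Y x y := by
  rw [ConjRule, Finset.insert_comm, Finset.union_insert, ← Finset.map_union] at h
  exact of_restrictsTo (restrictsTo_last_cnotSet one X x)
    (Finset.map_insert Fin.castSuccEmb x Y ▸ one_restrictsTo_cnotSet (insert x Y) y)
    (one_restrictsTo_cnotSet (X ∪ Y) y) h

lemma insert_pair_left (hab : a ≠ b) (ha : a ∉ X ∪ Y) (hb : b ∉ X ∪ Y)
    (hx : x ∉ insert a (insert b X)) (hy : y ∉ insert a (insert b X) ∪ Y)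
    (h : ConjRule (insert (Fin.last n) (X.map Fin.castSuccEmb)) (Y.map Fin.castSuccEmb)
      x.castSucc y.castSucc) : ConjRule (insert a (insert b X)) Y x y := by
  have hK := zero_restrictsTo_cnotSet_conj (x := y) hab ha hb (by simpa using hy)
  rw [← Finset.insert_union, ← Finset.insert_union, Finset.map_union, ← Finset.insert_union] at hK
  refine of_restrictsTo (zero_restrictsTo_cnotSet_conj hab (by grind) (by grind) hx)
    (Finset.map_insert Fin.castSuccEmb x Y ▸ restrictsTo_last_cnotSet zero (insert x Y) y) hK ?_
  refine conj_conj_of_conj_eq_mul (cnotSet_sq _ _) (cnotSet_commute ?_ ?_) ?_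
  · simp [last_ne_castSucc]
  · simp only [Finset.mem_insert, Finset.mem_union, not_or] at hy
    simp [hy.1]
  · simpa only [ConjRule, Finset.map_insert, Fin.coe_castSuccEmb] using h

lemma insert_right (hc : c ∉ Y) (hx : x ∉ X ∪ insert c Y) (hy : y ∉ insert x (X ∪ insert c Y))
    (h : ConjRule (X.map Fin.castSuccEmb) {c.castSucc} x.castSucc (Fin.last n))
    (h' : ConjRule ((insert c X).map Fin.castSuccEmb) (Y.map Fin.castSuccEmb)
      (Fin.last n) y.castSucc) : ConjRule X (insert c Y) x y := by
  have hunion : insert c X ∪ Y = X ∪ insert c Y := by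
    rw [Finset.union_insert, Finset.insert_union]
  rw [ConjRule, Finset.union_singleton] at h
  rw [ConjRule, ← Finset.map_union, hunion, Finset.map_insert, Fin.coe_castSuccEmb] at h'
  simp only [Finset.mem_insert, Finset.mem_union, not_or] at hx hy
  refine of_restrictsTo (restrictsTo_last_cnotSet zero X x)
    (zero_restrictsTo_cnotSet_conj hx.2.1 hx.2.2 hc (by simp [hy]))
    (restrictsTo_last_cnotSet zero _ y)
    (conj_conj_eq_mul_conj (cnotSet_sq _ _) h ?_ ?_ h' ?_)
  · exact cnotSet_commute (by simp [last_ne_castSucc]) (by simp [last_ne_castSucc])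
  · exact cnotSet_commute (by simp [hx, Fin.castSucc_ne_last]) (by simp [hy])
  · exact cnotSet_commute (by simp [last_ne_castSucc]) (by simp [hy])

lemma singleton_singleton (h : [a, x, c, y].Nodup) : ConjRule {a} {c} x y := by
  have hac : a ≠ c := by grind
  have hxc : x ≠ c := by grind
  change cnotSet {a} x * cnotSet {x, c} y * cnotSet {a} x = cnotSet {a, c} y * cnotSet {x, c} y
  rw [cnotSet_singleton, cnotSet_pair hxc, cnotSet_pair hac, cnot_tof_cnot h]

lemma pair_singleton (h : [a, c, x, y].Nodup) : ConjRule {c, a} {c} x y := by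
  have hac : a ≠ c := by grind
  have hcx : c ≠ x := by grind
  change cnotSet {c, a} x * cnotSet {x, c} y * cnotSet {c, a} x =
    cnotSet ({c, a} ∪ {c}) y * cnotSet {x, c} y
  rw [Finset.union_eq_left.2 (by simp), Finset.pair_comm c, Finset.pair_comm x, cnotSet_pair hac,
    cnotSet_pair hac, cnotSet_pair hcx, tof_tof_tof h]

lemma singleton_right_and_insert (hc : c ∉ X) (hx : x ∉ insert c X)
    (hy : y ∉ insert x (insert c X)) : ConjRule X {c} x y ∧ ConjRule (insert c X) {c} x y := by
  induction n, X using control_induction with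
  | empty n =>
    have hnodup : [x.castSucc, c.castSucc, y.castSucc].Nodup := by
      simp only [Finset.mem_insert, Finset.notMem_empty, or_false, not_or] at hx hy
      simp [hx, Ne.symm hy.1, Ne.symm hy.2]
    constructor
    · exact of_insert_last_left (singleton_singleton (by simpa [last_ne_castSucc] using hnodup))
    · refine of_insert_last_left ?_
      rw [insert_empty_eq, Finset.map_singleton, Fin.coe_castSuccEmb, Finset.pair_comm]
      exact pair_singleton (by grind [last_ne_castSucc])
  | singleton n a =>
    simp only [Finset.mem_insert, not_or, Finset.mem_singleton] at hc hx hy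
    exact ⟨singleton_singleton (by grind), pair_singleton (by grind)⟩
  | pair n a b X hab ha hb ih =>
    obtain ⟨h, h'⟩ := ih (c := c.castSucc) (x := x.castSucc) (y := y.castSucc)
      (by simp_all [Fin.castSucc_ne_last]) (by simp_all) (by simp_all)
    have hinsert : insert c (insert a (insert b X)) = insert a (insert b (insert c X)) := by
      rw [Finset.insert_comm c, Finset.insert_comm c]
    constructor
    · exact insert_pair_left hab (by grind) (by grind) (by grind) (by grind) h
    · rw [hinsert]
      refine insert_pair_left hab (by grind) (by grind) (by grind) (by grind) ?_
      rwa [Finset.map_insert, Finset.insert_comm]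

lemma singleton_right (hx : x ∉ X) (hxc : x ≠ c) (hy : y ∉ insert x (insert c X)) :
    ConjRule X {c} x y := by
  by_cases hc : c ∈ X
  · rw [← Finset.insert_erase hc]
    exact (singleton_right_and_insert (Finset.notMem_erase c X) (by grind) (by grind)).2
  · exact (singleton_right_and_insert hc (by grind) hy).1

end ConjRule

lemma conjRule (hx : x ∉ X ∪ Y) (hy : y ∉ insert x (X ∪ Y)) : ConjRule X Y x y := by
  induction hk : Y.card generalizing n with
  | zero =>
    obtain rfl := Finset.card_eq_zero.1 hk
    rw [Finset.union_empty] at hx hy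
    refine .of_insert_last_right (.singleton_right ?_ (Fin.castSucc_ne_last x) ?_)
    · simpa using hx
    · simpa [Fin.castSucc_ne_last] using hy
  | succ k ih =>
    obtain ⟨c, Y, hc, rfl, hY⟩ := Finset.card_eq_succ.1 hk
    obtain ⟨hxX, hxc⟩ : x ∉ X ∧ x ≠ c := by grind
    have hyXY : y ∉ insert c X ∪ Y := by grind
    refine .insert_right hc hx hy (.singleton_right ?_ ?_ ?_) (ih ?_ ?_ ?_)
    · simpa using hxX
    · simpa using hxc
    · simp [last_ne_castSucc]
    · simp [last_ne_castSucc]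
    · simpa [Fin.castSucc_ne_last] using hyXY
    · rw [Finset.card_map, hY]

lemma cnotSet_mul_cnotSet_insert (hx : x ∉ X ∪ Y) (hy : y ∉ insert x (X ∪ Y)) :
    cnotSet X x * cnotSet (insert x Y) y =
      cnotSet (X ∪ Y) y * (cnotSet (insert x Y) y * cnotSet X x) := by
  rw [← mul_assoc (cnotSet (X ∪ Y) y), ← conjRule hx hy, mul_assoc _ (cnotSet X x), cnotSet_sq,
    mul_one]

lemma zero_proj_mul_cnotSet_mul_cnotSet {z : Fin n} (hzx : z ≠ x) (hz : z ∉ X)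
    (hy : y ∉ insert z (insert x X)) :
    zero.proj z * (cnotSet {x} z * cnotSet (insert x X) y) =
      zero.proj z * (cnotSet {x} z * cnotSet (insert z X) y) := by
  simp only [Finset.mem_insert, not_or] at hy
  have hG : Commute (cnotSet (insert x X) y) (cnotSet (insert z X) y) :=
    cnotSet_commute (by simp [hy]) (by simp [hy])
  have hC : Commute (cnotSet {x} z) (cnotSet (insert x X) y) :=
    cnotSet_commute (by simp [hzx, hz]) (by simp [hy])
  have hconj : cnotSet {x} z * cnotSet (insert z X) y =
      cnotSet (insert x X) y * (cnotSet (insert z X) y * cnotSet {x} z) :=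
    cnotSet_mul_cnotSet_insert (X := {x}) (by simp [hzx, hz]) (by simp [hy])
  rw [hconj, hG.left_comm, ← mul_assoc (zero.proj z) (cnotSet (insert z X) y),
    zero_proj_mul_cnotSet_of_mem (Finset.mem_insert_self z X), hC.eq]

lemma zeroKet_comp_congr {z : Fin (n + 1)} {f g : Op (n + 1)}
    (h : zero.proj z * f = zero.proj z * g) : zeroKet z ≫ f = zeroKet z ≫ g := by
  have hproj : zeroKet z ≫ zero.proj z = zeroKet z := zero.create_proj z
  rw [← hproj, Category.assoc, Category.assoc]
  exact congrArg (zeroKet z ≫ ·) h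

end TOF

theorem mainTheorem7 :
    (∀ (n : ℕ) (X : Finset (Fin n)) (x : Fin n) (hx : x ∉ X),
      TOF.mcx X x hx ≫ TOF.mcx X x hx = 𝟙 (TOF.of n)) ∧
    (∀ (n : ℕ) (X : Finset (Fin (n + 1))) (x y : Fin (n + 1)) (_ : x ∈ X) (hy : y ∉ X),
      TOF.zeroKet x ≫ TOF.mcx X y hy = TOF.zeroKet x) ∧
    (∀ (n : ℕ) (X Y : Finset (Fin n)) (x : Fin n) (hX : x ∉ X) (hY : x ∉ Y),
      TOF.mcx X x hX ≫ TOF.mcx Y x hY = TOF.mcx Y x hY ≫ TOF.mcx X x hX) ∧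
    (∀ (n : ℕ) (X Y : Finset (Fin n)) (x y : Fin n) (hx : x ∉ X) (hy : y ∉ Y)
      (_ : x ∉ Y) (_ : y ∉ X),
      TOF.mcx X x hx ≫ TOF.mcx Y y hy = TOF.mcx Y y hy ≫ TOF.mcx X x hx) ∧
    (∀ (n : ℕ) (X Y : Finset (Fin n)) (x y : Fin n) (hx : x ∉ X) (_ : x ∉ Y)
      (hy : y ∉ insert x Y) (hy' : y ∉ X ∪ Y),
      TOF.mcx X x hx ≫ TOF.mcx (insert x Y) y hy =
        TOF.mcx (X ∪ Y) y hy' ≫ TOF.mcx (insert x Y) y hy ≫ TOF.mcx X x hx) ∧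
    (∀ (n : ℕ) (X : Finset (Fin (n + 1))) (x y z : Fin (n + 1)) (hz : z ∉ ({x} : Finset _))
      (_ : x ∉ X) (_ : z ∉ X) (hy : y ∉ insert x X) (hy' : y ∉ insert z X),
      TOF.zeroKet z ≫ TOF.mcx {x} z hz ≫ TOF.mcx (insert x X) y hy =
        TOF.zeroKet z ≫ TOF.mcx {x} z hz ≫ TOF.mcx (insert z X) y hy') := by
  simp only [TOF.mcx_eq_cnotSet]
  refine ⟨fun n X x _ => TOF.cnotSet_sq X x, fun n X x y hx _ => ?_,
    fun n X Y x hX hY => (TOF.cnotSet_commute hY hX).eq,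
    fun n X Y x y _ _ hx hy => (TOF.cnotSet_commute hx hy).eq,
    fun n X Y x y hX hY hy hy' => ?_, fun n X x y z hz _ hzX hy hy' => ?_⟩
  · refine (TOF.zeroKet_comp_congr (g := 1) ?_).trans (Category.comp_id _)
    rw [TOF.zero_proj_mul_cnotSet_of_mem hx, mul_one]
  · exact TOF.cnotSet_mul_cnotSet_insert (by simp [hX, hY]) (by grind)
  · exact TOF.zeroKet_comp_congr (TOF.zero_proj_mul_cnotSet_mul_cnotSet
      (by simpa using hz) hzX (by grind))
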